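/- Let $p$ be an odd prime and $L=\frac{p-1}{2}$. Let $\Gamma_0(p)\subset SL(2,\mathbb Z)$ act on the Riemann sphere $\mathbb C\cup\{\infty\}$ by Möbius transformations, write $z\sim w$ if $w=\gamma z$ for some $\gamma\in\Gamma_0(p)$, and let $\sigma z=-\bar z$, $\sigma\infty=\infty$. For a set $D$ of points of the upper half-plane $\mathbb H$ and cusps put $$\mathrm{Fix}(\sigma;D)=\{z\in D:\ \sigma z\sim z\}.$$ Let $\mathcal F=\{x+iy\in\mathbb H: |x|\le\frac12,\ x^2+y^2\ge1\}\cup\{\infty\}$, let $\alpha_l=\begin{pmatrix}0&-1\\1&-l\end{pmatrix}$ and $c_l=\alpha_l\bigl(-\frac12+i\frac{\sqrt3}{2}\bigr)$ for $l\in\mathbb Z$, and let $$\mathbb X_p=\mathcal F\cup\bigcup_{|l|\le L}\alpha_l\mathcal F .$$ Let $\widetilde{\mathbb X_p}$ be the quotient of $\mathbb X_p$ (with the topology induced from the sphere) by the relation $\sim$, and let $\mathrm{Fix}(\sigma;\widetilde{\mathbb X_p})$ be the image of $\mathrm{Fix}(\sigma;\mathbb X_p)$ in it. Finally let $\delta^{(p)}$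 be the set of points of $\mathrm{Fix}(\sigma;\mathbb X_p)$ with non-negative real part, where $\infty$ is included. Then: (i) $\delta^{(p)}$ is a simple curve from $c_L$ to $c_1$ (a path that does not meet itself, except that its end points coincide when $p=3$). It is the union of three hyperbolic geodesic arcs: the imaginary axis joining the cusps $0$ and $\infty$, the arc joining the cusp $0$ and $c_L$, and the vertical segment on $\Re z=\frac12$ joining $c_1$ and the cusp $\infty$. Moreover $\mathrm{Fix}(\sigma;\mathbb X_p)=\delta^{(p)}\cup\sigma\delta^{(p)}$. (ii) $\mathrm{Fix}(\sigma;\widetilde{\mathbb X_p})$ is a simple closed curve containing the cusp $\infty$. It is $\delta^{(p)}$ after gluing $c_L$ with $c_1$: it is the image of $\delta^{(p)}$, one has $c_L\sim c_1$, and two different points of $\delta^{(p)}$ are equivalent modulo $\Gamma_0(p)$ only if they are $c_L$ and $c_1$. (iii) Modulo $\Gamma_0(p)$, the set $\mathrm{Fix}(\sigma;\mathbb H)$ is the union of the two complete geodesics $\Re z=0$ (with end points $0,\infty$) and $\Re z=\frac12$ (with end points $\frac12,\infty$). These are inequivalent; in fact no two different points of their union are equivalent modulo $\Gamma_0(p)$.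 Their end points $0$ and $\frac12$ are equivalent modulo $\Gamma_0(p)$. -/

import Mathlib

open Set Filter Topology
open scoped Modular MatrixGroups UpperHalfPlane OnePoint

noncomputable section

namespace GammaZeroFix

/-- The Riemann sphere. It contains the upper half-plane and all the cusps; near the two cusps of
the domain `Xp` below, the subspace topology that `Xp` gets from the sphere is the same as the one
coming from horoball neighbourhoods, since `Xp` is a finite union of ideal triangles. -/
abbrev Sphere : Type := OnePoint ℂ

/-- The inclusion of the upper half-plane in the sphere. -/
def ofUHP (z : ℍ) : Sphere := ((z : ℂ) : OnePoint ℂ)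

/-- The action of `SL(2, ℤ)` on the sphere by Möbius transformations. -/
def moeb (γ : SL(2, ℤ)) (z : Sphere) : Sphere := Matrix.SpecialLinearGroup.mapGL ℂ γ • z

/-- The reflection `z ↦ -conj z`, which fixes the point at infinity. -/
def sigma : Sphere → Sphere := OnePoint.map fun z : ℂ => -(starRingEnd ℂ) z

/-- Equivalence of points of the sphere modulo `Γ`. -/
def orbitSetoid (Γ : Subgroup SL(2, ℤ)) : Setoid Sphere where
  r z w := ∃ γ ∈ Γ, moeb γ z = w
  iseqv :=
    { refl := fun z => ⟨1, Γ.one_mem, by simp [moeb]⟩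
      symm := by
        rintro z _ ⟨γ, hγ, rfl⟩
        exact ⟨γ⁻¹, Γ.inv_mem hγ, by simp only [moeb, smul_smul, ← map_mul]; simp⟩
      trans := by
        rintro z _ _ ⟨γ, hγ, rfl⟩ ⟨γ', hγ', rfl⟩
        exact ⟨γ' * γ, Γ.mul_mem hγ' hγ, by simp only [moeb, smul_smul, ← map_mul]⟩ }

/-- `Equiv₀ p z w`: the points `z` and `w` are equivalent modulo `Γ₀(p)`. -/
def Equiv₀ (p : ℕ) (z w : Sphere) : Prop := orbitSetoid (CongruenceSubgroup.Gamma0 p) z w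

/-- The points of `D` that are fixed by the reflection modulo `Γ`. -/
def fixSet (Γ : Subgroup SL(2, ℤ)) (D : Set Sphere) : Set Sphere :=
  {z | z ∈ D ∧ ∃ γ ∈ Γ, sigma z = moeb γ z}

/-- The closed standard domain `|Re z| ≤ 1/2`, `|z| ≥ 1` of the modular group, together with its
cusp at infinity. -/
def standardF : Set Sphere := insert ∞ (ofUHP '' ModularGroup.fd)

/-- The matrix `α_l = S T^(-l)`. -/
def alpha (l : ℤ) : SL(2, ℤ) := ⟨!![0, -1; 1, -l], by simp [Matrix.det_fin_two]⟩

/-- The point `1/2 + i √3/2`. -/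
def rho : Sphere := ((⟨1 / 2, Real.sqrt 3 / 2⟩ : ℂ) : OnePoint ℂ)

/-- The vertex `c_l`, the image of `-1/2 + i √3/2` under `α_l`. -/
def vertex (l : ℤ) : Sphere := moeb (alpha l) (sigma rho)

/-- The symmetric closed domain for `Γ₀(p)` (with its cusps): the union of the standard domain `F`
and of its images `α_l F` for `|l| ≤ (p - 1) / 2`. -/
def Xp (p : ℕ) : Set Sphere :=
  standardF ∪ ⋃ l ∈ {l : ℤ | |l| ≤ ((p : ℤ) - 1) / 2}, moeb (alpha l) '' standardF

/-- The part of the domain with non-negative real part; the cusp at infinity belongs to it. -/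
def XpPlus (p : ℕ) : Set Sphere := {z | z ∈ Xp p ∧ ∀ w : ℂ, z = (w : OnePoint ℂ) → 0 ≤ w.re}

/-- The points with non-negative real part in the domain that are fixed modulo `Γ₀(p)`. -/
def delta (p : ℕ) : Set Sphere := fixSet (CongruenceSubgroup.Gamma0 p) (XpPlus p)

/-- Two points of the domain are identified if they are equivalent modulo `Γ₀(p)`. -/
def gluing (p : ℕ) : Setoid (Xp p) :=
  (orbitSetoid (CongruenceSubgroup.Gamma0 p)).comap Subtype.val

/-- The symmetric standard fundamental domain: the surface obtained from `Xp` by identifying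
equivalent points, with the quotient topology. -/
def XpTilde (p : ℕ) : Type := Quotient (gluing p)

instance (p : ℕ) : TopologicalSpace (XpTilde p) :=
  inferInstanceAs (TopologicalSpace (Quotient (gluing p)))

/-- The projection of `Xp` onto the glued surface. -/
def proj (p : ℕ) (z : Xp p) : XpTilde p := Quotient.mk (gluing p) z

/-- The set of points of the glued surface that come from the points of `D`. -/
def glue (p : ℕ) (D : Set Sphere) : Set (XpTilde p) := {x | ∃ z : Xp p, (z : Sphere) ∈ D ∧ proj p z = x}

/-- The fixed set of the reflection on the glued surface. -/
def fixTilde (p : ℕ) : Set (XpTilde p) :=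
  glue p (fixSet (CongruenceSubgroup.Gamma0 p) (Xp p))

/-- A simple closed curve: the image of an embedding of the circle. -/
def IsSimpleClosedCurve {X : Type*} [TopologicalSpace X] (C : Set X) : Prop :=
  ∃ f : Circle → X, IsEmbedding f ∧ range f = C

/-- `C` is a simple curve from `a` to `b`: it is traced by a path that takes no value twice, except
that its end points are allowed to coincide. -/
def IsSimpleCurve {X : Type*} [TopologicalSpace X] (a b : X) (C : Set X) : Prop :=
  ∃ h : Path a b, range h = C ∧
    ∀ s t : unitInterval, s < t → h s = h t → s = 0 ∧ t = 1

/-- `A` is the hyperbolic geodesic arc from `a` to `b` (including its end points, each of which may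
be in the upper half-plane or on its boundary): it is traced by an injective path that stays in the
upper half-plane between its end points and along which the hyperbolic distance is additive. -/
def IsGeodesicArc (a b : Sphere) (A : Set Sphere) : Prop :=
  ∃ h : Path a b, Function.Injective h ∧ range h = A ∧
    (∀ t : unitInterval, 0 < t → t < 1 → h t ∈ range ofUHP) ∧
    ∀ (s t u : unitInterval) (x y z : ℍ), s ≤ t → t ≤ u →
      h s = ofUHP x → h t = ofUHP y → h u = ofUHP z → dist x z = dist x y + dist y z

/-- `l` is a complete hyperbolic geodesic (a subset of the upper half-plane) with end points `a` and
`b` on the boundary. -/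
def IsCompleteGeodesic (a b : Sphere) (l : Set Sphere) : Prop :=
  ∃ f : ℝ → ℍ, Isometry f ∧ range (ofUHP ∘ f) = l ∧
    Tendsto (ofUHP ∘ f) atBot (𝓝 a) ∧ Tendsto (ofUHP ∘ f) atTop (𝓝 b)

/-- The line `Re z = r` in the upper half-plane. -/
def verticalLine (r : ℝ) : Set Sphere := ofUHP '' {z : ℍ | z.re = r}

/-- The class of a point modulo `Γ₀(p)`. -/
def orbitMap (p : ℕ) : Sphere → Quotient (orbitSetoid (CongruenceSubgroup.Gamma0 p)) :=
  Quotient.mk _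

end GammaZeroFix

end

namespace GammaZeroFix

/-! ### The action on the sphere and on the upper half-plane -/

/-! Write `a, b, c, d` for the entries of `γ` and `D = |z|²`. The equation `γ z = -conj z` says that
`a = d` and that `z` lies on the geodesic `c D + 2 a Re z + b = 0` (`reflect_eq_smul_iff`). Its
determinant is `a² - b c = 1`, so for `c ≠ 0` its end points `(-a ± 1)/c` are rational. As `p` is an
odd prime dividing `(a - 1)(a + 1)`, one end point has reduced denominator divisible by `p`, hence
is equivalent to `∞`. Moving it there makes the geodesic a line `2 Re z ∈ ℤ`, and a translation
makes it `Re z = 0` or `Re z = 1/2` (`exists_smul_line`). No two points of these lines are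
identified, because an integer product attached to such an identification lies in `[0, 4)` and is
`4` modulo `p` (`eq_of_smul_eq_of_lines`). This is (iii).

Inside `Xp`, the equation of the geodesic and the inequalities of the domain leave, for `Re z ≥ 0`,
only the imaginary axis, the part of `Re z = 1/2` above `c_1`, and the boundary arc `2 Re z = p D`
from `0` to `c_L` (`onDelta_of_fixed`; conversely `OnDelta.mem_Xp`). The matrix `gluingMat` carries
this arc to the missing lower part of `Re z = 1/2`, with `0 ↦ 1/2` and `c_L ↦ c_1`. So `delta` is
the two lines of (iii) with one of them cut at `c_1`, and its identifications follow from those of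
the lines (`equiv₀_iff_of_mem_delta`).

For the topology in (ii), the path tracing `delta` descends to an injective map of the circle into
the quotient. That it is an embedding follows from its being closed, which needs the saturation of a
closed subset of `delta` to be closed (`isClosed_saturation`); no separation property of the
quotient is used. -/

lemma det_eq_one (γ : SL(2, ℤ)) : γ 0 0 * γ 1 1 - γ 0 1 * γ 1 0 = 1 := by
  have h := γ.det_coe
  rwa [Matrix.det_fin_two] at h

lemma det_eq_one_real (γ : SL(2, ℤ)) :
    (γ 0 0 : ℝ) * γ 1 1 - γ 0 1 * γ 1 0 = 1 := by
  exact_mod_cast det_eq_one γ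

lemma moeb_infty (γ : SL(2, ℤ)) :
    moeb γ ∞ = if γ 1 0 = 0 then ∞ else (((γ 0 0 : ℂ) / (γ 1 0 : ℂ) : ℂ) : OnePoint ℂ) := by
  simp [moeb, OnePoint.smul_infty_eq_ite]

lemma moeb_some (γ : SL(2, ℤ)) (z : ℂ) :
    moeb γ (z : OnePoint ℂ) = if (γ 1 0 : ℂ) * z + γ 1 1 = 0 then ∞ else
      ((((γ 0 0 : ℂ) * z + γ 0 1) / ((γ 1 0 : ℂ) * z + γ 1 1) : ℂ) : OnePoint ℂ) := by
  simp [moeb, OnePoint.smul_some_eq_ite]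

lemma moeb_mul (γ γ' : SL(2, ℤ)) (z : Sphere) : moeb (γ * γ') z = moeb γ (moeb γ' z) := by
  simp only [moeb, smul_smul, ← map_mul]

lemma moeb_one (z : Sphere) : moeb 1 z = z := by simp [moeb]

lemma moeb_inv_moeb (γ : SL(2, ℤ)) (z : Sphere) : moeb γ⁻¹ (moeb γ z) = z := by
  rw [← moeb_mul, inv_mul_cancel, moeb_one]

lemma moeb_injective (γ : SL(2, ℤ)) : Function.Injective (moeb γ) :=
  Function.LeftInverse.injective (moeb_inv_moeb γ)

lemma ofUHP_injective : Function.Injective ofUHP := fun _ _ h =>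
  UpperHalfPlane.ext (OnePoint.coe_injective h)

lemma ofUHP_ne_infty (z : ℍ) : ofUHP z ≠ ∞ := OnePoint.coe_ne_infty _

lemma coe_eq_ofUHP_im_pos {w : ℂ} {z : ℍ} (h : (w : OnePoint ℂ) = ofUHP z) : 0 < w.im := by
  rw [OnePoint.coe_injective h]; exact z.im_pos

lemma denom_ne_zero (γ : SL(2, ℤ)) (z : ℍ) : (γ 1 0 : ℂ) * z + γ 1 1 ≠ 0 := by
  intro h
  have h1 := congrArg Complex.im h
  have h2 := congrArg Complex.re h
  simp at h1 h2
  have hd := det_eq_one γ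
  rcases h1 with h1 | h1
  · rw [h1] at h2 hd
    simp at h2
    rw [h2] at hd
    simp at hd
  · exact z.im_pos.ne' h1

lemma coe_smul (γ : SL(2, ℤ)) (z : ℍ) :
    ((γ • z : ℍ) : ℂ) = ((γ 0 0 : ℂ) * z + γ 0 1) / ((γ 1 0 : ℂ) * z + γ 1 1) := by
  rw [UpperHalfPlane.coe_specialLinearGroup_apply]
  simp

lemma moeb_ofUHP (γ : SL(2, ℤ)) (z : ℍ) : moeb γ (ofUHP z) = ofUHP (γ • z) := by
  rw [ofUHP, moeb_some, if_neg (denom_ne_zero γ z), ofUHP, coe_smul]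

lemma smul_eq_iff (γ : SL(2, ℤ)) (z w : ℍ) : γ • z = w ↔
    γ 0 0 * z.re + γ 0 1 = w.re * (γ 1 0 * z.re + γ 1 1) - w.im * (γ 1 0 * z.im) ∧
    γ 0 0 * z.im = w.re * (γ 1 0 * z.im) + w.im * (γ 1 0 * z.re + γ 1 1) := by
  rw [UpperHalfPlane.ext_iff, coe_smul, div_eq_iff (denom_ne_zero γ z), Complex.ext_iff]
  simp

lemma exists_smul_of_moeb {γ : SL(2, ℤ)} {z : Sphere} {w : ℍ} (h : moeb γ z = ofUHP w) :
    z = ofUHP (γ⁻¹ • w) := by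
  rw [← moeb_ofUHP, ← h, moeb_inv_moeb]

lemma mem_Gamma0_iff {p : ℕ} {γ : SL(2, ℤ)} :
    γ ∈ CongruenceSubgroup.Gamma0 p ↔ (p : ℤ) ∣ γ 1 0 := by
  rw [CongruenceSubgroup.Gamma0_mem, ZMod.intCast_zmod_eq_zero_iff_dvd]

/-- The integral matrix with given entries and determinant one. -/
def mat (a b c d : ℤ) (h : a * d - b * c = 1) : SL(2, ℤ) :=
  ⟨!![a, b; c, d], by rw [Matrix.det_fin_two]; simpa using h⟩

section
variable (a b c d : ℤ) (h : a * d - b * c = 1)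
@[simp] lemma mat_zero_zero : mat a b c d h 0 0 = a := rfl
@[simp] lemma mat_zero_one : mat a b c d h 0 1 = b := rfl
@[simp] lemma mat_one_zero : mat a b c d h 1 0 = c := rfl
@[simp] lemma mat_one_one : mat a b c d h 1 1 = d := rfl
end

lemma mul_one_zero (γ γ' : SL(2, ℤ)) : (γ * γ') 1 0 = γ 1 0 * γ' 0 0 + γ 1 1 * γ' 1 0 := by
  simp [Matrix.mul_apply, Fin.sum_univ_two]

lemma mul_one_one (γ γ' : SL(2, ℤ)) : (γ * γ') 1 1 = γ 1 0 * γ' 0 1 + γ 1 1 * γ' 1 1 := by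
  simp [Matrix.mul_apply, Fin.sum_univ_two]

lemma inv_zero_zero (γ : SL(2, ℤ)) : γ⁻¹ 0 0 = γ 1 1 := by
  simp [Matrix.SpecialLinearGroup.coe_inv, Matrix.adjugate_fin_two]

lemma inv_one_zero (γ : SL(2, ℤ)) : γ⁻¹ 1 0 = -γ 1 0 := by
  simp [Matrix.SpecialLinearGroup.coe_inv, Matrix.adjugate_fin_two]

/-! ### The reflection -/

lemma sigma_infty : sigma ∞ = ∞ := rfl

lemma sigma_some (z : ℂ) :
    sigma (z : OnePoint ℂ) = ((-(starRingEnd ℂ) z : ℂ) : OnePoint ℂ) := rfl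

lemma sigma_sigma (z : Sphere) : sigma (sigma z) = z := by
  induction z using OnePoint.rec with
  | infty => rfl
  | coe z => simp [sigma_some]

lemma continuous_sigma : Continuous sigma := by
  refine OnePoint.continuous_map (by fun_prop) ?_
  rw [coclosedCompact_eq_cocompact]
  exact ((Homeomorph.neg ℂ).isClosedEmbedding.tendsto_cocompact).comp
    (Complex.conjLIE.toHomeomorph.isClosedEmbedding.tendsto_cocompact)

/-- The reflection `z ↦ -conj z` of the upper half-plane. -/
def reflect (z : ℍ) : ℍ := ⟨⟨-z.re, z.im⟩, z.im_pos⟩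

@[simp] lemma reflect_re (z : ℍ) : (reflect z).re = -z.re := rfl
@[simp] lemma reflect_im (z : ℍ) : (reflect z).im = z.im := rfl

lemma sigma_ofUHP (z : ℍ) : sigma (ofUHP z) = ofUHP (reflect z) := by
  rw [ofUHP, sigma_some, ofUHP]
  congr 1
  apply Complex.ext <;> simp

/-- The conjugate of an integral matrix by the reflection. -/
def reflectConj (γ : SL(2, ℤ)) : SL(2, ℤ) :=
  mat (γ 0 0) (-γ 0 1) (-γ 1 0) (γ 1 1) (by linarith [det_eq_one γ])

lemma sigma_moeb (γ : SL(2, ℤ)) (z : Sphere) :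
    sigma (moeb γ z) = moeb (reflectConj γ) (sigma z) := by
  induction z using OnePoint.rec with
  | infty =>
    rw [sigma_infty, moeb_infty, moeb_infty]
    by_cases h : γ 1 0 = 0
    · simp [reflectConj, h, sigma_infty]
    · simp [reflectConj, h, sigma_some, div_neg]
  | coe z =>
    have key : ((reflectConj γ 1 0 : ℤ) : ℂ) * -(starRingEnd ℂ) z + (reflectConj γ 1 1 : ℤ)
        = (starRingEnd ℂ) ((γ 1 0 : ℂ) * z + γ 1 1) := by
      simp [reflectConj]
    rw [sigma_some, moeb_some, moeb_some, key]
    by_cases h : (γ 1 0 : ℂ) * z + γ 1 1 = 0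
    · simp only [h, map_zero, if_true, sigma_infty]
    · rw [if_neg h, if_neg ((map_ne_zero (starRingEnd ℂ)).2 h), sigma_some]
      congr 1
      rw [map_div₀, ← neg_div]
      congr 1
      simp [reflectConj]
      ring

lemma reflectConj_mem {p : ℕ} {γ : SL(2, ℤ)} (h : γ ∈ CongruenceSubgroup.Gamma0 p) :
    reflectConj γ ∈ CongruenceSubgroup.Gamma0 p := by
  rw [mem_Gamma0_iff] at h ⊢
  simpa [reflectConj] using h

/-- The fixed set of a product of a matrix with the reflection. -/
lemma reflect_eq_smul_iff (γ : SL(2, ℤ)) (z : ℍ) : γ • z = reflect z ↔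
    γ 0 0 = γ 1 1 ∧
      (γ 1 0 : ℝ) * (z.re ^ 2 + z.im ^ 2) + 2 * γ 0 0 * z.re + γ 0 1 = 0 := by
  rw [smul_eq_iff, reflect_re, reflect_im]
  have hy := z.im_pos
  constructor
  · rintro ⟨h1, h2⟩
    have h3 : (γ 0 0 : ℝ) = γ 1 1 := by
      have : ((γ 0 0 : ℝ) - γ 1 1) * z.im = 0 := by linarith
      rcases mul_eq_zero.1 this with h | h
      · linarith
      · exact absurd h hy.ne'
    exact ⟨by exact_mod_cast h3, by rw [← h3] at h1; linarith⟩
  · rintro ⟨h1, h2⟩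
    rw [← h1]
    constructor <;> linarith

lemma equiv₀_iff {p : ℕ} {z w : Sphere} :
    Equiv₀ p z w ↔ ∃ γ ∈ CongruenceSubgroup.Gamma0 p, moeb γ z = w := Iff.rfl

lemma Equiv₀.symm {p : ℕ} {z w : Sphere} (h : Equiv₀ p z w) : Equiv₀ p w z :=
  (orbitSetoid _).symm h

lemma Equiv₀.trans {p : ℕ} {z w v : Sphere} (h : Equiv₀ p z w) (h' : Equiv₀ p w v) :
    Equiv₀ p z v :=
  (orbitSetoid _).trans h h'

lemma Equiv₀.refl (p : ℕ) (z : Sphere) : Equiv₀ p z z := (orbitSetoid _).refl z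

lemma Equiv₀.sigma {p : ℕ} {z w : Sphere} (h : Equiv₀ p z w) :
    Equiv₀ p (sigma z) (sigma w) := by
  obtain ⟨γ, hγ, rfl⟩ := h
  exact ⟨reflectConj γ, reflectConj_mem hγ, (sigma_moeb γ z).symm⟩

lemma mem_fixSet_iff {p : ℕ} {D : Set Sphere} {z : Sphere} :
    z ∈ fixSet (CongruenceSubgroup.Gamma0 p) D ↔ z ∈ D ∧ Equiv₀ p z (sigma z) := by
  simp only [fixSet, mem_ofPred_eq, equiv₀_iff, eq_comm]

/-- The reflection normalises `Γ₀(p)`, so being fixed modulo `Γ₀(p)` is a property of the whole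
class. -/
lemma Equiv₀.fixed {p : ℕ} {z w : Sphere} (h : Equiv₀ p z w)
    (hw : Equiv₀ p w (GammaZeroFix.sigma w)) : Equiv₀ p z (GammaZeroFix.sigma z) :=
  (h.trans hw).trans h.sigma.symm

lemma equiv₀_ofUHP_iff {p : ℕ} {z w : ℍ} :
    Equiv₀ p (ofUHP z) (ofUHP w) ↔ ∃ γ ∈ CongruenceSubgroup.Gamma0 p, γ • z = w := by
  simp only [equiv₀_iff, moeb_ofUHP, ofUHP_injective.eq_iff]


/-! ### Points fixed modulo `Γ₀(p)` and vertical lines -/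

section
variable {p : ℕ}

/-- If `c = 0`, `γ` is a translation up to sign and parity gives `j = k`. If `c ≠ 0`, the integer `N
= (2a - kc)(2d + jc)` is `4` modulo `p` and satisfies `0 ≤ N < 4`. This forces `p = 3` and `N = 1`,
and then both points lie on `Re = 1/2` at the same height. -/
lemma eq_of_smul_eq_of_lines (hp : p.Prime) (hp2 : p ≠ 2) {γ : SL(2, ℤ)}
    (hγ : γ ∈ CongruenceSubgroup.Gamma0 p) {z w : ℍ} (hzw : γ • z = w) {j k : ℤ}
    (hj : j = 0 ∨ j = 1) (hk : k = 0 ∨ k = 1) (hz : 2 * z.re = j) (hw : 2 * w.re = k) :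
    z = w := by
  obtain ⟨h1, h2⟩ := (smul_eq_iff γ z w).1 hzw
  have hdet := det_eq_one_real γ
  have hdetZ := det_eq_one γ
  rw [mem_Gamma0_iff] at hγ
  have hy := z.im_pos
  have hv := w.im_pos
  have hp3 : 3 ≤ p := by have := hp.two_le; omega
  generalize γ 0 0 = a at *
  generalize γ 0 1 = b at *
  generalize γ 1 0 = c at *
  generalize γ 1 1 = d at *
  have hx : z.re = j / 2 := by linarith
  have hu : w.re = k / 2 := by linarith
  rw [hx, hu] at h1 h2
  by_cases hc : c = 0
  · subst hc
    simp only [Int.cast_zero, zero_mul, mul_zero, zero_add, sub_zero] at h1 h2 hdetZ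
    have had : (a = 1 ∧ d = 1) ∨ (a = -1 ∧ d = -1) := by
      have := Int.isUnit_iff.1 (IsUnit.of_mul_eq_one d hdetZ)
      rcases this with h | h <;> subst h <;> [left; right] <;> constructor <;> omega
    rcases had with ⟨rfl, rfl⟩ | ⟨rfl, rfl⟩
    · have e : j + 2 * b = k := by
        have : (j : ℝ) + 2 * b = k := by push_cast at h1; linarith
        exact_mod_cast this
      have : j = k := by omega
      subst this
      apply UpperHalfPlane.ext
      apply Complex.ext
      · simpa using hx.trans hu.symm
      · push_cast at h2
        simp; linarith
    · have e : j - 2 * b = k := by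
        have : (j : ℝ) - 2 * b = k := by push_cast at h1; linarith
        exact_mod_cast this
      have : j = k := by omega
      subst this
      apply UpperHalfPlane.ext
      apply Complex.ext
      · simpa using hx.trans hu.symm
      · push_cast at h2
        simp; linarith
  · have hcR : (0 : ℝ) < (c : ℝ) ^ 2 := by positivity
    -- The real and imaginary parts of `γ z = w`, cleared of denominators: `e1` bounds the product
    -- above, and `e2` shows that its two factors have the same sign.
    have e1 : ((2 * a - k * c : ℝ) * (2 * d + j * c)) = 4 - 4 * (w.im * z.im * c ^ 2) := by
      linear_combination 4 * hdet + 4 * c * h1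
    have e2 : (2 * a - k * c : ℝ) * z.im = w.im * (2 * d + j * c) := by
      linear_combination 2 * h2
    have hlt : ((2 * a - k * c : ℝ) * (2 * d + j * c)) < 4 := by
      rw [e1]
      have : 0 < w.im * z.im * c ^ 2 := by positivity
      linarith
    have hge : 0 ≤ ((2 * a - k * c : ℝ) * (2 * d + j * c)) := by
      have : ((2 * a - k * c : ℝ) * (2 * d + j * c)) * z.im
          = w.im * (2 * d + j * c) ^ 2 := by
        linear_combination (2 * d + j * c : ℝ) * e2
      have h3 : 0 ≤ ((2 * a - k * c : ℝ) * (2 * d + j * c)) * z.im := by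
        rw [this]; positivity
      exact nonneg_of_mul_nonneg_left h3 hy
    have hltZ : (2 * a - k * c) * (2 * d + j * c) < 4 := by exact_mod_cast hlt
    have hgeZ : 0 ≤ (2 * a - k * c) * (2 * d + j * c) := by exact_mod_cast hge
    have hdvd : (p : ℤ) ∣ 4 - (2 * a - k * c) * (2 * d + j * c) := by
      have : 4 - (2 * a - k * c) * (2 * d + j * c)
          = c * (-4 * b + 2 * k * d - 2 * a * j + k * j * c) := by
        linear_combination (-4) * hdetZ
      rw [this]
      exact Dvd.dvd.mul_right hγ _
    -- `4 - N` is a positive multiple of an odd `p ≥ 3` and is at most `4`, so it equals `3`.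
    have hN : (2 * a - k * c) * (2 * d + j * c) = 1 := by
      generalize (2 * a - k * c) * (2 * d + j * c) = N at *
      obtain ⟨m, hm⟩ := hdvd
      have hodd : p % 2 = 1 := hp.eq_two_or_odd.resolve_left hp2
      have hm0 : 0 < m := by
        by_contra hcon
        have : (p : ℤ) * m ≤ 0 := mul_nonpos_of_nonneg_of_nonpos (by positivity) (by omega)
        omega
      have hm1 : m = 1 := by
        by_contra hcon
        have : 3 * 2 ≤ (p : ℤ) * m := mul_le_mul (by omega) (by omega) (by omega) (by omega)
        omega
      subst hm1
      omega
    have hcase : (2 * a - k * c = 1 ∧ 2 * d + j * c = 1) ∨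
        (2 * a - k * c = -1 ∧ 2 * d + j * c = -1) := Int.mul_eq_one_iff_eq_one_or_neg_one.1 hN
    have hk1 : k = 1 := by
      rcases hk with rfl | rfl
      · omega
      · rfl
    have hj1 : j = 1 := by
      rcases hj with rfl | rfl
      · omega
      · rfl
    have him : z.im = w.im := by
      rcases hcase with ⟨ha, hd⟩ | ⟨ha, hd⟩
      · have ha' : (2 * a - k * c : ℝ) = 1 := by exact_mod_cast ha
        have hd' : (2 * d + j * c : ℝ) = 1 := by exact_mod_cast hd
        rw [ha', hd'] at e2; linarith
      · have ha' : (2 * a - k * c : ℝ) = -1 := by exact_mod_cast ha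
        have hd' : (2 * d + j * c : ℝ) = -1 := by exact_mod_cast hd
        rw [ha', hd'] at e2; linarith
    apply UpperHalfPlane.ext
    apply Complex.ext
    · simp [hx, hu, hk1, hj1]
    · simpa using him

lemma exists_two_mul_re_eq_int {γ : SL(2, ℤ)} {z : ℍ} (h : γ • z = reflect z)
    (hc : γ 1 0 = 0) : ∃ n : ℤ, 2 * z.re = n := by
  obtain ⟨h1, h2⟩ := (reflect_eq_smul_iff γ z).1 h
  have hdet := det_eq_one γ
  rw [← h1, hc, mul_zero, sub_zero] at hdet
  rw [hc, Int.cast_zero, zero_mul, zero_add] at h2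
  refine ⟨-(γ 0 0 * γ 0 1), ?_⟩
  have hdet' : (γ 0 0 : ℝ) * γ 0 0 = 1 := by exact_mod_cast hdet
  push_cast
  linear_combination (-2 * z.re) * hdet' + (γ 0 0 : ℝ) * h2

lemma reflect_smul (g : SL(2, ℤ)) (z : ℍ) : reflect (g • z) = reflectConj g • reflect z := by
  apply ofUHP_injective
  rw [← sigma_ofUHP, ← moeb_ofUHP, ← moeb_ofUHP, sigma_moeb, sigma_ofUHP]

/-- The translation by `n`. -/
def shift (n : ℤ) : SL(2, ℤ) := mat 1 n 0 1 (by ring)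

lemma shift_mem (p : ℕ) (n : ℤ) : shift n ∈ CongruenceSubgroup.Gamma0 p := by
  rw [mem_Gamma0_iff]; simp [shift]

lemma shift_smul_re (n : ℤ) (z : ℍ) : (shift n • z).re = z.re + n := by
  have h := (smul_eq_iff (shift n) z _).1 rfl
  generalize shift n • z = w at h ⊢
  simp [shift] at h
  linarith [h.1]

/-- The fixed geodesic has a cusp equivalent to `∞`; conjugating the reflection by a matrix of
`Γ₀(p)` that moves this cusp to `∞` gives lower left entry `0`. -/
lemma exists_smul_two_mul_re_eq_int (hp : p.Prime) (hp2 : p ≠ 2) {γ : SL(2, ℤ)}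
    (hγ : γ ∈ CongruenceSubgroup.Gamma0 p) {z : ℍ} (h : γ • z = reflect z) :
    ∃ g ∈ CongruenceSubgroup.Gamma0 p, ∃ n : ℤ, 2 * (g • z).re = n := by
  by_cases hc : γ 1 0 = 0
  · exact ⟨1, one_mem _, by simpa using exists_two_mul_re_eq_int h hc⟩
  obtain ⟨had, -⟩ := (reflect_eq_smul_iff γ z).1 h
  have hdet := det_eq_one γ
  rw [← had] at hdet
  rw [mem_Gamma0_iff] at hγ
  have hpZ : Prime (p : ℤ) := Nat.prime_iff_prime_int.1 hp
  -- The sign selects the end point `-(a + ε)/c`: since `p` does not divide `a + ε`, the factor `p`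
  -- of `c` survives in the reduced denominator `v`.
  obtain ⟨ε, hε, hdvd⟩ : ∃ ε : ℤ, ε ^ 2 = 1 ∧ (p : ℤ) ∣ γ 0 0 - ε := by
    have : (p : ℤ) ∣ (γ 0 0 - 1) * (γ 0 0 + 1) := by
      have e : (γ 0 0 - 1) * (γ 0 0 + 1) = γ 0 1 * γ 1 0 := by linear_combination hdet
      rw [e]; exact hγ.mul_left _
    rcases hpZ.dvd_or_dvd this with h | h
    · exact ⟨1, by norm_num, h⟩
    · exact ⟨-1, by norm_num, by simpa using h⟩
  have hndvd : ¬ (p : ℤ) ∣ γ 0 0 + ε := by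
    intro h'
    have h2 : (p : ℤ) ∣ 2 := by
      have := (dvd_sub h' hdvd).mul_left ε
      have e : ε * (γ 0 0 + ε - (γ 0 0 - ε)) = 2 := by linear_combination 2 * hε
      rwa [e] at this
    have : p ∣ 2 := by exact_mod_cast h2
    exact hp2 ((Nat.prime_dvd_prime_iff_eq hp Nat.prime_two).1 this)
  obtain ⟨u, v, hcop, hu, hv⟩ : ∃ u v : ℤ, IsCoprime u v ∧
      -(γ 0 0 + ε) = u * (Int.gcd (-(γ 0 0 + ε)) (γ 1 0)) ∧
      γ 1 0 = v * (Int.gcd (-(γ 0 0 + ε)) (γ 1 0)) := by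
    obtain ⟨u, v, hcop, hu, hv⟩ := Int.exists_gcd_one
      (m := -(γ 0 0 + ε)) (n := γ 1 0) (Int.gcd_pos_of_ne_zero_right _ hc)
    exact ⟨u, v, Int.isCoprime_iff_gcd_eq_one.2 hcop, hu, hv⟩
  generalize ((Int.gcd (-(γ 0 0 + ε)) (γ 1 0) : ℕ) : ℤ) = g at hu hv
  have hg : g ≠ 0 := by rintro rfl; exact hc (by simpa using hv)
  have hpv : (p : ℤ) ∣ v := by
    rw [hv] at hγ
    rcases hpZ.dvd_or_dvd hγ with h | h
    · exact h
    · exact absurd (by rw [← dvd_neg, hu]; exact h.mul_left u) hndvd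
  -- `u/v` is a root of the quadratic form of the geodesic.
  have hQ : γ 1 0 * u ^ 2 + 2 * γ 0 0 * u * v + γ 0 1 * v ^ 2 = 0 := by
    have : (γ 1 0 * u ^ 2 + 2 * γ 0 0 * u * v + γ 0 1 * v ^ 2) * g ^ 2 = 0 := by
      have e : (γ 1 0 * u ^ 2 + 2 * γ 0 0 * u * v + γ 0 1 * v ^ 2) * g ^ 2 =
          γ 1 0 * (u * g) ^ 2 + 2 * γ 0 0 * (u * g) * (v * g) + γ 0 1 * (v * g) ^ 2 := by ring
      rw [e, ← hu, ← hv]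
      linear_combination (-γ 1 0) * hdet + γ 1 0 * hε
    exact (mul_eq_zero.1 this).resolve_right (pow_ne_zero 2 hg)
  obtain ⟨r, s, hrs⟩ := hcop
  -- This matrix sends `u/v` to `∞`; it lies in `Γ₀(p)` because `p ∣ v`.
  refine ⟨mat (-r) (-s) v (-u) (by linarith), ?_, ?_⟩
  · rw [mem_Gamma0_iff]; simpa using hpv
  · set m := mat (-r) (-s) v (-u) (by linarith) with hm
    refine exists_two_mul_re_eq_int (γ := reflectConj m * γ * m⁻¹) ?_ ?_
    · rw [reflect_smul, ← h, mul_smul, mul_smul, inv_smul_smul]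
    · rw [mul_one_zero, mul_one_zero, mul_one_one, inv_zero_zero, inv_one_zero, ← had]
      simp only [reflectConj, hm, mat_zero_zero, mat_zero_one, mat_one_zero, mat_one_one]
      linear_combination hQ

lemma exists_smul_line (hp : p.Prime) (hp2 : p ≠ 2) {γ : SL(2, ℤ)}
    (hγ : γ ∈ CongruenceSubgroup.Gamma0 p) {z : ℍ} (h : γ • z = reflect z) :
    ∃ g ∈ CongruenceSubgroup.Gamma0 p, (g • z).re = 0 ∨ (g • z).re = 1 / 2 := by
  obtain ⟨g, hg, n, hn⟩ := exists_smul_two_mul_re_eq_int hp hp2 hγ h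
  rcases Int.even_or_odd' n with ⟨m, rfl | rfl⟩
  · refine ⟨shift (-m) * g, mul_mem (shift_mem p _) hg, Or.inl ?_⟩
    rw [mul_smul, shift_smul_re]
    push_cast at hn ⊢
    linarith
  · refine ⟨shift (-m) * g, mul_mem (shift_mem p _) hg, Or.inr ?_⟩
    rw [mul_smul, shift_smul_re]
    push_cast at hn ⊢
    linarith

lemma equiv₀_sigma_of_re_eq_zero {z : ℍ} (h : z.re = 0) :
    Equiv₀ p (ofUHP z) (sigma (ofUHP z)) := by
  rw [sigma_ofUHP, equiv₀_ofUHP_iff]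
  exact ⟨1, one_mem _, (reflect_eq_smul_iff 1 z).2 (by simp [h])⟩

lemma equiv₀_sigma_of_re_eq_half {z : ℍ} (h : z.re = 1 / 2) :
    Equiv₀ p (ofUHP z) (sigma (ofUHP z)) := by
  rw [sigma_ofUHP, equiv₀_ofUHP_iff]
  exact ⟨shift (-1), shift_mem p _, (reflect_eq_smul_iff _ z).2 (by simp [h, shift])⟩

lemma eq_of_equiv₀_of_lines (hp : p.Prime) (hp2 : p ≠ 2) {z w : ℍ}
    (hz : z.re = 0 ∨ z.re = 1 / 2) (hw : w.re = 0 ∨ w.re = 1 / 2)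
    (h : Equiv₀ p (ofUHP z) (ofUHP w)) : z = w := by
  obtain ⟨γ, hγ, h⟩ := equiv₀_ofUHP_iff.1 h
  have key : ∀ z : ℍ, z.re = 0 ∨ z.re = 1 / 2 →
      ∃ j : ℤ, (j = 0 ∨ j = 1) ∧ 2 * z.re = j := by
    rintro z (h | h)
    · exact ⟨0, Or.inl rfl, by simp [h]⟩
    · exact ⟨1, Or.inr rfl, by simp [h]⟩
  obtain ⟨j, hj, hzj⟩ := key z hz
  obtain ⟨k, hk, hwk⟩ := key w hw
  exact eq_of_smul_eq_of_lines hp hp2 hγ h hj hk hzj hwk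

lemma mem_verticalLine_iff {r : ℝ} {s : Sphere} :
    s ∈ verticalLine r ↔ ∃ z : ℍ, z.re = r ∧ ofUHP z = s := Iff.rfl

lemma injOn_orbitMap (hp : p.Prime) (hp2 : p ≠ 2) :
    InjOn (orbitMap p) (verticalLine 0 ∪ verticalLine (1 / 2)) := by
  have key : ∀ s ∈ verticalLine 0 ∪ verticalLine (1 / 2),
      ∃ z : ℍ, (z.re = 0 ∨ z.re = 1 / 2) ∧ ofUHP z = s := by
    rintro s (⟨z, hz, rfl⟩ | ⟨z, hz, rfl⟩)
    · exact ⟨z, Or.inl hz, rfl⟩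
    · exact ⟨z, Or.inr hz, rfl⟩
  intro s hs t ht hst
  obtain ⟨z, hz, rfl⟩ := key s hs
  obtain ⟨w, hw, rfl⟩ := key t ht
  rw [eq_of_equiv₀_of_lines hp hp2 hz hw (Quotient.exact hst)]

lemma image_orbitMap_fixSet (hp : p.Prime) (hp2 : p ≠ 2) :
    orbitMap p '' fixSet (CongruenceSubgroup.Gamma0 p) (range ofUHP) =
      orbitMap p '' verticalLine 0 ∪ orbitMap p '' verticalLine (1 / 2) := by
  apply Subset.antisymm
  · rintro _ ⟨_, ⟨⟨z, rfl⟩, γ, hγ, h⟩, rfl⟩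
    rw [sigma_ofUHP, moeb_ofUHP, ofUHP_injective.eq_iff] at h
    obtain ⟨g, hg, h⟩ := exists_smul_line hp hp2 hγ h.symm
    have e : orbitMap p (ofUHP (g • z)) = orbitMap p (ofUHP z) :=
      (Quotient.sound ⟨g, hg, moeb_ofUHP g z⟩ : orbitMap p (ofUHP z) = _).symm
    rcases h with h | h
    · exact Or.inl ⟨_, ⟨g • z, h, rfl⟩, e⟩
    · exact Or.inr ⟨_, ⟨g • z, h, rfl⟩, e⟩
  · rintro _ (⟨_, ⟨z, hz, rfl⟩, rfl⟩ | ⟨_, ⟨z, hz, rfl⟩, rfl⟩)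
    · exact ⟨_, mem_fixSet_iff.2 ⟨⟨z, rfl⟩, equiv₀_sigma_of_re_eq_zero hz⟩, rfl⟩
    · exact ⟨_, mem_fixSet_iff.2 ⟨⟨z, rfl⟩, equiv₀_sigma_of_re_eq_half hz⟩, rfl⟩

lemma image_verticalLine_ne (hp : p.Prime) (hp2 : p ≠ 2) {γ : SL(2, ℤ)}
    (hγ : γ ∈ CongruenceSubgroup.Gamma0 p) :
    moeb γ '' verticalLine 0 ≠ verticalLine (1 / 2) := by
  intro h
  have hI := UpperHalfPlane.I_re
  obtain ⟨w, hw, hw'⟩ := mem_verticalLine_iff.1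
    (h ▸ ⟨_, ⟨_, hI, rfl⟩, rfl⟩ : moeb γ (ofUHP UpperHalfPlane.I) ∈ verticalLine (1 / 2))
  have e := eq_of_equiv₀_of_lines hp hp2 (Or.inl hI) (Or.inr hw) ⟨γ, hγ, hw'.symm⟩
  rw [← e, hI] at hw
  norm_num at hw

lemma equiv₀_zero_half {L : ℤ} (hL : 2 * L + 1 = (p : ℤ)) :
    Equiv₀ p ((0 : ℂ) : OnePoint ℂ) ((1 / 2 : ℂ) : OnePoint ℂ) := by
  refine ⟨mat (L + 1) 1 p 2 (by linarith), by rw [mem_Gamma0_iff]; simp, ?_⟩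
  rw [moeb_some]
  simp

end


/-! ### The domain in coordinates -/

lemma alpha_zero_zero (l : ℤ) : alpha l 0 0 = 0 := rfl
lemma alpha_zero_one (l : ℤ) : alpha l 0 1 = -1 := rfl
lemma alpha_one_zero (l : ℤ) : alpha l 1 0 = 1 := rfl
lemma alpha_one_one (l : ℤ) : alpha l 1 1 = -l := rfl

lemma moeb_alpha_infty (l : ℤ) : moeb (alpha l) ∞ = ((0 : ℂ) : OnePoint ℂ) := by
  rw [moeb_infty, alpha_zero_zero, alpha_one_zero]
  simp

lemma zero_ne_ofUHP (z : ℍ) : ((0 : ℂ) : OnePoint ℂ) ≠ ofUHP z := fun h => by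
  simpa using coe_eq_ofUHP_im_pos h

/-- Rounding, clipped to `[-L, L]`: at the ends `±(L + 1/2)` the nearest integer may be out of
range. -/
lemma exists_int_near {r : ℝ} {L : ℤ} (h : |r| ≤ L + 1 / 2) :
    ∃ l : ℤ, |l| ≤ L ∧ |r - l| ≤ 1 / 2 := by
  have hr := abs_sub_round r
  rw [abs_le] at h hr
  by_cases h1 : L < round r
  · refine ⟨L, ?_, ?_⟩
    · have : (0 : ℝ) ≤ L + 1 / 2 := by linarith
      have : (-1 : ℝ) < L := by linarith
      have : -1 < L := by exact_mod_cast this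
      rw [abs_of_nonneg (by omega)]
    · have : (L : ℝ) + 1 ≤ round r := by exact_mod_cast h1
      rw [abs_le]; constructor <;> linarith
  by_cases h2 : round r < -L
  · refine ⟨-L, ?_, ?_⟩
    · have : (0 : ℝ) ≤ L + 1 / 2 := by linarith
      have : (-1 : ℝ) < L := by linarith
      have : -1 < L := by exact_mod_cast this
      rw [abs_neg, abs_of_nonneg (by omega)]
    · have : (round r : ℝ) + 1 ≤ -L := by exact_mod_cast h2
      rw [abs_le]; push_cast; constructor <;> linarith
  · exact ⟨round r, abs_le.2 ⟨by omega, by omega⟩, abs_le.2 hr⟩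

lemma sq_le_sq_sub_int {t : ℝ} (h : |t| ≤ 1 / 2) (m : ℤ) : t ^ 2 ≤ (t - m) ^ 2 := by
  rw [abs_le] at h
  rcases lt_trichotomy m 0 with hm | rfl | hm
  · have : (m : ℝ) ≤ -1 := by exact_mod_cast (by omega : m ≤ -1)
    nlinarith
  · simp
  · have : (1 : ℝ) ≤ m := by exact_mod_cast (by omega : 1 ≤ m)
    nlinarith

lemma mem_fd_iff (z : ℍ) :
    z ∈ ModularGroup.fd ↔ 1 ≤ z.re ^ 2 + z.im ^ 2 ∧ |z.re| ≤ 1 / 2 := by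
  rw [ModularGroup.fd, mem_ofPred_eq, Complex.normSq_apply, ← sq, ← sq]
  rfl

lemma re_sq_add_im_sq_pos (z : ℍ) : 0 < z.re ^ 2 + z.im ^ 2 := by
  have := z.im_pos
  positivity

lemma alpha_smul_eq_iff (l : ℤ) (w z : ℍ) : alpha l • w = z ↔
    (z.re ^ 2 + z.im ^ 2) * (w.re - l) = -z.re ∧ (z.re ^ 2 + z.im ^ 2) * w.im = z.im := by
  rw [smul_eq_iff, alpha_zero_zero, alpha_zero_one, alpha_one_zero, alpha_one_one]
  push_cast
  constructor
  · rintro ⟨h1, h2⟩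
    constructor
    · linear_combination -z.re * h1 - z.im * h2
    · linear_combination z.im * h1 - z.re * h2
  · rintro ⟨h1, h2⟩
    have hD := (re_sq_add_im_sq_pos z).ne'
    constructor <;> apply mul_left_cancel₀ hD
    · linear_combination -z.re * h1 + z.im * h2
    · linear_combination -z.im * h1 - z.re * h2

section
variable {p : ℕ} {L : ℤ}

/-- The part of the domain below the unit circle, in coordinates. -/
def InLower (p : ℕ) (z : ℍ) : Prop :=
  2 * |z.re| ≤ p * (z.re ^ 2 + z.im ^ 2) ∧
    ∀ n : ℤ, 0 ≤ 1 + 2 * n * z.re + (n ^ 2 - 1) * (z.re ^ 2 + z.im ^ 2)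

/-- As `α_l w = -1/(w - l)`, the conditions are about `-1/z = w - l`. Its real part is `-Re z/D`,
bounded by `L + 1/2 = p/2`. The inequality for `n` in `InLower` is `D (|-1/z - n|² - 1) ≥ 0`: every
integral translate of `-1/z` stays outside the open unit disc. -/
lemma exists_alpha_iff (hL : 2 * L + 1 = (p : ℤ)) (z : ℍ) :
    (∃ l : ℤ, |l| ≤ L ∧ ∃ w ∈ ModularGroup.fd, alpha l • w = z) ↔ InLower p z := by
  have hD := re_sq_add_im_sq_pos z
  have hLR : 2 * (L : ℝ) + 1 = p := by exact_mod_cast hL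
  constructor
  · rintro ⟨l, hl, w, hw, hwz⟩
    obtain ⟨h1, h2⟩ := (mem_fd_iff w).1 hw
    obtain ⟨e1, e2⟩ := (alpha_smul_eq_iff l w z).1 hwz
    have e3 : (z.re ^ 2 + z.im ^ 2) * ((w.re - l) ^ 2 + w.im ^ 2) = 1 := by
      apply mul_left_cancel₀ hD.ne'
      linear_combination ((z.re ^ 2 + z.im ^ 2) * (w.re - l) - z.re) * e1 +
        ((z.re ^ 2 + z.im ^ 2) * w.im + z.im) * e2
    unfold InLower
    generalize z.re ^ 2 + z.im ^ 2 = D at *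
    constructor
    · have hx : |z.re| = D * |w.re - l| := by
        rw [← abs_neg, ← e1, abs_mul, abs_of_pos hD]
      have : |w.re - l| ≤ 1 / 2 + L := by
        have hl' : |(l : ℝ)| ≤ L := by exact_mod_cast hl
        exact (abs_sub _ _).trans (add_le_add h2 hl')
      rw [hx]
      nlinarith
    · intro n
      have := sq_le_sq_sub_int h2 (l + n)
      push_cast at this
      have e : 1 + 2 * n * z.re + (n ^ 2 - 1) * D
          = D * ((w.re - (l + n)) ^ 2 + w.im ^ 2 - 1) := by
        linear_combination (2 * n : ℝ) * e1 - e3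
      rw [e]
      apply mul_nonneg hD.le
      linarith
  · rintro ⟨h1, h2⟩
    obtain ⟨l, hl, hl'⟩ := exists_int_near (r := z.re / (z.re ^ 2 + z.im ^ 2)) (L := L) (by
      rw [abs_div, abs_of_pos hD, div_le_iff₀ hD]
      rw [← hLR] at h1
      linarith)
    refine ⟨l, hl, (alpha l)⁻¹ • z, ?_, by rw [smul_inv_smul]⟩
    obtain ⟨e1, e2⟩ := (alpha_smul_eq_iff l ((alpha l)⁻¹ • z) z).1 (smul_inv_smul _ _)
    rw [mem_fd_iff]
    generalize (alpha l)⁻¹ • z = w at *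
    have e3 : (z.re ^ 2 + z.im ^ 2) * ((w.re - l) ^ 2 + w.im ^ 2) = 1 := by
      apply mul_left_cancel₀ hD.ne'
      linear_combination ((z.re ^ 2 + z.im ^ 2) * (w.re - l) - z.re) * e1 +
        ((z.re ^ 2 + z.im ^ 2) * w.im + z.im) * e2
    generalize z.re ^ 2 + z.im ^ 2 = D at *
    constructor
    · have h3 := h2 (-l)
      have e : 1 + 2 * ((-l : ℤ) : ℝ) * z.re + (((-l : ℤ) : ℝ) ^ 2 - 1) * D
          = D * (w.re ^ 2 + w.im ^ 2 - 1) := by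
        push_cast
        linear_combination (-2 * l : ℝ) * e1 - e3
      rw [e] at h3
      have := nonneg_of_mul_nonneg_right h3 hD
      linarith
    · have : z.re / D = l - w.re := by
        rw [div_eq_iff hD.ne']; linear_combination e1
      rw [this] at hl'
      rw [← abs_neg]
      convert hl' using 2
      ring

lemma ofUHP_mem_standardF_iff (z : ℍ) : ofUHP z ∈ standardF ↔ z ∈ ModularGroup.fd := by
  simp [standardF, ofUHP_ne_infty, ofUHP_injective.eq_iff]

lemma mem_Xp_iff (hL : 2 * L + 1 = (p : ℤ)) (s : Sphere) : s ∈ Xp p ↔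
    s ∈ standardF ∨ ∃ l : ℤ, |l| ≤ L ∧ ∃ t ∈ standardF, moeb (alpha l) t = s := by
  have : ((p : ℤ) - 1) / 2 = L := by omega
  simp only [Xp, this, mem_union, mem_iUnion, mem_ofPred_eq, mem_image, exists_prop]

lemma ofUHP_mem_Xp_iff (hL : 2 * L + 1 = (p : ℤ)) (z : ℍ) : ofUHP z ∈ Xp p ↔
    (1 ≤ z.re ^ 2 + z.im ^ 2 ∧ |z.re| ≤ 1 / 2) ∨ InLower p z := by
  rw [mem_Xp_iff hL, ofUHP_mem_standardF_iff, mem_fd_iff, ← exists_alpha_iff hL]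
  apply or_congr_right
  apply exists_congr
  intro l
  apply and_congr_right
  intro _
  constructor
  · rintro ⟨t, ht, h⟩
    rcases ht with rfl | ⟨w, hw, rfl⟩
    · rw [moeb_alpha_infty] at h
      exact absurd h (zero_ne_ofUHP z)
    · exact ⟨w, hw, ofUHP_injective (by rw [← moeb_ofUHP, h])⟩
  · rintro ⟨w, hw, rfl⟩
    exact ⟨ofUHP w, (ofUHP_mem_standardF_iff w).2 hw, moeb_ofUHP _ _⟩

lemma infty_mem_Xp (p : ℕ) : (∞ : Sphere) ∈ Xp p := Or.inl (mem_insert _ _)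

lemma zero_mem_Xp (hL : 2 * L + 1 = (p : ℤ)) : ((0 : ℂ) : OnePoint ℂ) ∈ Xp p :=
  (mem_Xp_iff hL _).2 (Or.inr ⟨0, by simp; omega, ∞, mem_insert _ _, moeb_alpha_infty 0⟩)

lemma cases_of_mem_Xp (hL : 2 * L + 1 = (p : ℤ)) {s : Sphere} (h : s ∈ Xp p) :
    s = ∞ ∨ s = ((0 : ℂ) : OnePoint ℂ) ∨ ∃ z : ℍ, ofUHP z = s := by
  rcases (mem_Xp_iff hL s).1 h with h | ⟨l, -, t, ht, rfl⟩
  · rcases h with rfl | ⟨z, -, rfl⟩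
    · exact Or.inl rfl
    · exact Or.inr (Or.inr ⟨z, rfl⟩)
  · rcases ht with rfl | ⟨z, -, rfl⟩
    · exact Or.inr (Or.inl (moeb_alpha_infty l))
    · exact Or.inr (Or.inr ⟨_, (moeb_ofUHP _ _).symm⟩)

lemma sigma_zero : sigma ((0 : ℂ) : OnePoint ℂ) = ((0 : ℂ) : OnePoint ℂ) := by
  rw [sigma_some]; simp

lemma sigma_mem_Xp (hL : 2 * L + 1 = (p : ℤ)) {s : Sphere} (h : s ∈ Xp p) : sigma s ∈ Xp p := by
  rcases cases_of_mem_Xp hL h with rfl | rfl | ⟨z, rfl⟩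
  · exact h
  · rwa [sigma_zero]
  · rw [ofUHP_mem_Xp_iff hL] at h
    rw [sigma_ofUHP, ofUHP_mem_Xp_iff hL]
    simp only [InLower, reflect_re, reflect_im, abs_neg, neg_sq] at h ⊢
    refine h.imp_right fun ⟨h1, h2⟩ => ⟨h1, fun n => ?_⟩
    have := h2 (-n)
    push_cast at this
    linarith

/-! ### The fixed points in the domain -/

/-- The translate of `-1/z` nearest to the imaginary axis has modulus at least `1` and real part at
most `1/2` in absolute value, so its height `Im z/D` is at least `√3/2`. -/
lemma InLower.im_sq {z : ℍ} (h : InLower p z) :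
    3 * (z.re ^ 2 + z.im ^ 2) ^ 2 ≤ 4 * z.im ^ 2 := by
  obtain ⟨-, h2⟩ := h
  have hD := re_sq_add_im_sq_pos z
  set D := z.re ^ 2 + z.im ^ 2 with hDdef
  set n := -round (z.re / D)
  have h3 := h2 n
  have hr := abs_sub_round (z.re / D)
  have e : z.re / D - round (z.re / D) = (z.re + n * D) / D := by
    simp only [n]; push_cast; field_simp; ring
  rw [e, abs_div, abs_of_pos hD, div_le_iff₀ hD] at hr
  have hs : (z.re + n * D) ^ 2 ≤ (1 / 2 * D) ^ 2 :=
    sq_le_sq' (by linarith [(abs_le.1 hr).1]) (abs_le.1 hr).2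
  nlinarith [mul_nonneg hD.le h3]

/-- The fixed points with non-negative real part, in coordinates. -/
def OnDelta (p : ℕ) (z : ℍ) : Prop :=
  z.re = 0 ∨ (z.re = 1 / 2 ∧ 1 ≤ 12 * z.im ^ 2) ∨
    (2 * z.re = p * (z.re ^ 2 + z.im ^ 2) ∧ 3 * (z.re ^ 2 + z.im ^ 2) ^ 2 ≤ 4 * z.im ^ 2)

lemma onDelta_of_two_mul_re_eq_int (hL : 2 * L + 1 = (p : ℤ)) {z : ℍ} (hz : ofUHP z ∈ Xp p)
    (h0 : 0 ≤ z.re) {n : ℤ} (hn : 2 * z.re = n) : OnDelta p z := by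
  rw [ofUHP_mem_Xp_iff hL] at hz
  have hx : z.re ≤ 1 / 2 := by
    rcases hz with h | h
    · exact (abs_le.1 h.2).2
    · have := h.2 (-1)
      push_cast at this
      linarith
  have hn0 : 0 ≤ n := by exact_mod_cast (by linarith : (0 : ℝ) ≤ n)
  have hn1 : n ≤ 1 := by exact_mod_cast (by linarith : (n : ℝ) ≤ 1)
  obtain rfl | rfl : n = 0 ∨ n = 1 := by omega
  · left
    push_cast at hn
    linarith
  · right; left
    have hx' : z.re = 1 / 2 := by push_cast at hn; linarith
    refine ⟨hx', ?_⟩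
    rcases hz with h | h
    · have := h.1
      rw [hx'] at this
      linarith
    -- On `Re z = 1/2` the inequality for `-2` reads `3 D ≥ 1`, that is `12 (Im z)² ≥ 1`: the line
    -- enters the domain at `c_1`.
    · have := h.2 (-2)
      rw [hx'] at this
      push_cast at this
      linarith

/-- In the coordinate `-1/z` the geodesic has radius `1/|b|` if `b ≠ 0`, while the domain lies above
height `√3/2`; hence `b` is `0` or `±1`. If `b = 0`, then `2 Re z = |c| D ≥ p D` puts `z` on the
boundary arc. If `b = ±1`, `-1/z` is on the unit circle about `n = a b`, and `p ∣ n² - 1`. -/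
lemma onDelta_of_inLower (hp : p.Prime) (hp2 : p ≠ 2) {z : ℍ} (hz : InLower p z)
    (h0 : 0 ≤ z.re) {a b c : ℤ} (hdet : a * a - b * c = 1) (hpc : (p : ℤ) ∣ c) (hc : c ≠ 0)
    (h : (c : ℝ) * (z.re ^ 2 + z.im ^ 2) + 2 * a * z.re + b = 0) : OnDelta p z := by
  have hD := re_sq_add_im_sq_pos z
  have h34 := hz.im_sq
  obtain ⟨hw, hn⟩ := hz
  rw [abs_of_nonneg h0] at hw
  have hp3 : 3 ≤ p := by have := hp.two_le; omega
  have hdetR : (a : ℝ) * a - b * c = 1 := by exact_mod_cast hdet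
  have hy := z.im_pos
  have hbig : (b : ℝ) ^ 2 * z.im ^ 2 ≤ (z.re ^ 2 + z.im ^ 2) ^ 2 := by
    have e : (z.re ^ 2 + z.im ^ 2) ^ 2 - (b : ℝ) ^ 2 * z.im ^ 2 =
        (b * z.re + a * (z.re ^ 2 + z.im ^ 2)) ^ 2 := by
      linear_combination (-(z.re ^ 2 + z.im ^ 2) ^ 2) * hdetR -
        (z.re ^ 2 + z.im ^ 2) * b * h
    have := sq_nonneg (b * z.re + a * (z.re ^ 2 + z.im ^ 2))
    linarith
  by_cases hb : b = 0
  · right; right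
    refine ⟨?_, h34⟩
    subst hb
    have ha : a = 1 ∨ a = -1 := by
      apply Int.isUnit_iff.1
      exact IsUnit.of_mul_eq_one a (by linarith)
    generalize z.re ^ 2 + z.im ^ 2 = D at *
    apply le_antisymm hw
    push_cast at h
    rcases ha with rfl | rfl
    · have hneg : (c : ℝ) ≤ 0 := by
        by_contra hcon
        push_cast at h
        nlinarith
      have hneg' : c ≤ 0 := by exact_mod_cast hneg
      have hpc' : (p : ℤ) ≤ -c := Int.le_of_dvd (by omega) (by rwa [dvd_neg])
      have hpcR : (p : ℝ) ≤ -c := by exact_mod_cast hpc'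
      have := mul_le_mul_of_nonneg_right hpcR hD.le
      push_cast at h
      linarith
    · have hnonneg : 0 ≤ (c : ℝ) := by
        by_contra hcon
        push_cast at h
        nlinarith
      have hnonneg' : 0 ≤ c := by exact_mod_cast hnonneg
      have hpc' : (p : ℤ) ≤ c := Int.le_of_dvd (by omega) hpc
      have hpcR : (p : ℝ) ≤ c := by exact_mod_cast hpc'
      have := mul_le_mul_of_nonneg_right hpcR hD.le
      push_cast at h
      linarith
  · have hb1 : b ^ 2 = 1 := by
      have h1 : (b : ℝ) ^ 2 < 2 := by
        by_contra hcon
        have : 2 * z.im ^ 2 ≤ (b : ℝ) ^ 2 * z.im ^ 2 :=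
          mul_le_mul_of_nonneg_right (not_lt.1 hcon) (sq_nonneg _)
        have : 0 < z.im ^ 2 := by positivity
        linarith
      have h2 : b ^ 2 < 2 := by exact_mod_cast h1
      have h3 : 0 < b ^ 2 := by positivity
      omega
    obtain ⟨n, hnab⟩ : ∃ n : ℤ, n = a * b := ⟨_, rfl⟩
    have hn2 : n ^ 2 - 1 = b * c := by
      rw [hnab]; linear_combination a ^ 2 * hb1 + hdet
    have hb1R : (b : ℝ) ^ 2 = 1 := by exact_mod_cast hb1
    have hn2R : (n : ℝ) ^ 2 - 1 = b * c := by exact_mod_cast hn2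
    have hnabR : (n : ℝ) = a * b := by exact_mod_cast hnab
    have hdvd : (p : ℤ) ∣ (n - 1) * (n + 1) := by
      have e : (n - 1) * (n + 1) = b * c := by linear_combination hn2
      rw [e]
      exact hpc.mul_left b
    obtain ⟨D, hDdef⟩ : ∃ D, D = z.re ^ 2 + z.im ^ 2 := ⟨_, rfl⟩
    have heq : 1 + 2 * n * z.re + (n ^ 2 - 1) * D = 0 := by
      rw [hDdef]
      linear_combination (z.re ^ 2 + z.im ^ 2) * hn2R - hb1R + b * h + 2 * z.re * hnabR
    have hplus := hn (n + 1)
    have hminus := hn (n - 1)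
    rw [OnDelta]
    rw [← hDdef] at hw hplus hminus hD h34 ⊢
    push_cast at hplus hminus
    -- Comparing the circle about `n` with its neighbours about `n ± 1` gives `-(p + 1)/2 ≤ n ≤ 0`.
    -- With `n ≡ ±1` modulo `p` there remain `n = -1`, which is the line `Re z = 1/2`, and `n = -2`
    -- for `p = 3`.
    have hup : 2 * n < 2 := by
      have : (2 * n : ℝ) * D < 2 * D := by linarith
      exact_mod_cast lt_of_mul_lt_mul_right this hD.le
    have hlow : -((p : ℤ) + 1) ≤ 2 * n := by
      have : (-(p + 1) : ℝ) * D ≤ (2 * n) * D := by linarith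
      exact_mod_cast le_of_mul_le_mul_right this hD
    have hn1 : n ≠ 0 := by
      rintro rfl
      have := Int.le_of_dvd one_pos (by simpa using hdvd)
      omega
    by_cases hnn : n = -1
    · right; left
      subst hnn
      have hx : z.re = 1 / 2 := by push_cast at heq; linarith
      refine ⟨hx, ?_⟩
      rw [hx] at hDdef hminus
      push_cast at hminus
      linarith
    · have hpZ : Prime (p : ℤ) := Nat.prime_iff_prime_int.1 hp
      have hcases : p = 3 ∧ n = -2 := by
        rcases hpZ.dvd_or_dvd hdvd with h' | h'
        · have := Int.le_of_dvd (b := 1 - n) (by omega) ((dvd_sub_comm).1 h')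
          have hodd : p % 2 = 1 := hp.eq_two_or_odd.resolve_left hp2
          have : p = 3 := by omega
          omega
        · have : (p : ℤ) ≤ -(n + 1) := Int.le_of_dvd (by omega) (by rwa [dvd_neg])
          omega
      -- The inequalities now leave the single point `Re z = 1/2`, `D = 1/3`, the common vertex `c_L
      -- = c_1` for `p = 3`.
      obtain ⟨rfl, rfl⟩ := hcases
      right; right
      refine ⟨?_, h34⟩
      apply le_antisymm hw
      push_cast at hminus hplus heq ⊢
      linarith

lemma onDelta_of_fixed (hp : p.Prime) (hp2 : p ≠ 2) (hL : 2 * L + 1 = (p : ℤ)) {z : ℍ}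
    (hz : ofUHP z ∈ Xp p) (h0 : 0 ≤ z.re) (hfix : Equiv₀ p (ofUHP z) (sigma (ofUHP z))) :
    OnDelta p z := by
  rw [sigma_ofUHP, equiv₀_ofUHP_iff] at hfix
  obtain ⟨γ, hγ, hγz⟩ := hfix
  by_cases hc : γ 1 0 = 0
  · obtain ⟨n, hn⟩ := exists_two_mul_re_eq_int hγz hc
    exact onDelta_of_two_mul_re_eq_int hL hz h0 hn
  obtain ⟨had, h⟩ := (reflect_eq_smul_iff γ z).1 hγz
  have hdet := det_eq_one γ
  rw [← had] at hdet
  rw [mem_Gamma0_iff] at hγ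
  rcases (ofUHP_mem_Xp_iff hL z).1 hz with hF | hW
  -- A geodesic with `c ≠ 0` has radius `1/|c| ≤ 1/3`, but the standard domain lies above height
  -- `√3/2`.
  · exfalso
    have hp3 : 3 ≤ p := by
      have := hp.two_le
      omega
    have hc3 : 3 ≤ |γ 1 0| := by
      have := Int.le_of_dvd (abs_pos.2 hc) ((dvd_abs _ _).2 hγ)
      omega
    have hc3R : (3 : ℝ) ≤ |(γ 1 0 : ℝ)| := by exact_mod_cast hc3
    have hc9 : (3 : ℝ) ^ 2 ≤ (γ 1 0 : ℝ) ^ 2 := by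
      rw [← sq_abs (γ 1 0 : ℝ)]
      exact pow_le_pow_left₀ (by norm_num) hc3R 2
    have hdetR : (γ 0 0 : ℝ) * γ 0 0 - γ 0 1 * γ 1 0 = 1 := by exact_mod_cast hdet
    have e : (γ 1 0 : ℝ) ^ 2 * z.im ^ 2 = 1 - (γ 1 0 * z.re + γ 0 0) ^ 2 := by
      linear_combination (γ 1 0 : ℝ) * h + hdetR
    have h1 : z.re ^ 2 ≤ (1 / 2) ^ 2 := by
      rw [← sq_abs]
      exact pow_le_pow_left₀ (abs_nonneg _) hF.2 2
    have h2 : (3 : ℝ) ^ 2 * z.im ^ 2 ≤ (γ 1 0 : ℝ) ^ 2 * z.im ^ 2 :=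
      mul_le_mul_of_nonneg_right hc9 (sq_nonneg _)
    have h3 := sq_nonneg (γ 1 0 * z.re + γ 0 0)
    linarith [hF.1]
  · exact onDelta_of_inLower hp hp2 hW h0 hdet hγ hc h

end


/-! ### Gluing of the fixed points in the domain -/

section
variable {p : ℕ} {L : ℤ}

/-- The element of `Γ₀(p)` that glues the lower boundary arc to the line `Re z = 1 / 2`. -/
def gluingMat (hL : 2 * L + 1 = (p : ℤ)) : SL(2, ℤ) := mat L (-1) p (-2) (by linarith)

lemma gluingMat_mem (hL : 2 * L + 1 = (p : ℤ)) :
    gluingMat hL ∈ CongruenceSubgroup.Gamma0 p := by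
  rw [mem_Gamma0_iff]; simp [gluingMat]

lemma gluingMat_smul_eq_iff (hL : 2 * L + 1 = (p : ℤ)) {z w : ℍ} (hw : w.re = 1 / 2) :
    gluingMat hL • z = w ↔ 2 * z.re = p * (z.re ^ 2 + z.im ^ 2) ∧
      4 * w.im * z.im = z.re ^ 2 + z.im ^ 2 := by
  have hLR : 2 * (L : ℝ) + 1 = p := by exact_mod_cast hL
  have hy := z.im_pos
  rw [smul_eq_iff, hw]
  simp only [gluingMat, mat_zero_zero, mat_zero_one, mat_one_zero, mat_one_one]
  push_cast
  constructor
  · rintro ⟨h1, h2⟩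
    have hD : 4 * w.im * z.im = z.re ^ 2 + z.im ^ 2 := by
      linear_combination (2 * z.re) * h1 + (2 * z.im) * h2 - (z.re ^ 2 + z.im ^ 2) * hLR
    refine ⟨?_, hD⟩
    linear_combination (-4) * h1 + p * hD + 2 * z.re * hLR
  · rintro ⟨h1, h2⟩
    constructor
    · linear_combination (-1 / 4 : ℝ) * h1 + (p / 4 : ℝ) * h2 + z.re / 2 * hLR
    · apply mul_right_cancel₀ hy.ne'
      linear_combination (z.im ^ 2 / 2) * hLR - (p * z.re - 2) / 4 * h2 + z.re / 4 * h1

/-- The image of a point of the boundary arc has height `D/(4 Im z)`, so the bound `Im(-1/z) ≥ √3/2`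
turns into height at most `√3/6`, the height of `c_1`. -/
lemma exists_gluingMat_smul_iff (hL : 2 * L + 1 = (p : ℤ)) (z : ℍ) :
    (2 * z.re = p * (z.re ^ 2 + z.im ^ 2) ∧ 3 * (z.re ^ 2 + z.im ^ 2) ^ 2 ≤ 4 * z.im ^ 2) ↔
      (gluingMat hL • z).re = 1 / 2 ∧ 12 * (gluingMat hL • z).im ^ 2 ≤ 1 := by
  have hy := z.im_pos
  have hD := re_sq_add_im_sq_pos z
  constructor
  · rintro ⟨h1, h2⟩
    have hpos : 0 < (z.re ^ 2 + z.im ^ 2) / (4 * z.im) := by positivity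
    have e := (gluingMat_smul_eq_iff hL (z := z)
      (w := ⟨⟨1 / 2, (z.re ^ 2 + z.im ^ 2) / (4 * z.im)⟩, hpos⟩) rfl).2
      ⟨h1, by change 4 * ((z.re ^ 2 + z.im ^ 2) / (4 * z.im)) * z.im = _; field_simp⟩
    rw [e]
    refine ⟨rfl, ?_⟩
    change 12 * ((z.re ^ 2 + z.im ^ 2) / (4 * z.im)) ^ 2 ≤ 1
    rw [div_pow, ← mul_div_assoc, div_le_one (by positivity)]
    linarith
  · rintro ⟨h1, h2⟩
    obtain ⟨h3, h4⟩ := (gluingMat_smul_eq_iff hL h1).1 rfl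
    refine ⟨h3, ?_⟩
    rw [← h4]
    have := mul_le_mul_of_nonneg_right h2 (sq_nonneg z.im)
    linarith

lemma OnDelta.re_nonneg {z : ℍ} (h : OnDelta p z) : 0 ≤ z.re := by
  have hD := re_sq_add_im_sq_pos z
  rcases h with h | h | h
  · exact h.ge
  · rw [h.1]; norm_num
  · have : 0 ≤ (p : ℝ) * (z.re ^ 2 + z.im ^ 2) := by positivity
    linarith [h.1]

lemma OnDelta.mem_Xp (hp : p.Prime) (hp2 : p ≠ 2) (hL : 2 * L + 1 = (p : ℤ)) {z : ℍ}
    (h : OnDelta p z) : ofUHP z ∈ Xp p := by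
  have hy := z.im_pos
  have hD := re_sq_add_im_sq_pos z
  have hp3 : 3 ≤ p := hp.two_le.lt_of_ne' hp2
  have hp3R : (3 : ℝ) ≤ p := by exact_mod_cast hp3
  rw [ofUHP_mem_Xp_iff hL]
  rcases le_or_gt 1 (z.re ^ 2 + z.im ^ 2) with h1 | h1
  · rcases h with h | h | h
    · exact Or.inl ⟨h1, by simp [h]⟩
    · exact Or.inl ⟨h1, by rw [h.1, abs_of_nonneg (by norm_num)]⟩
    · exfalso
      have h2 : z.re = p / 2 * (z.re ^ 2 + z.im ^ 2) := by linarith [h.1]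
      have h3 : 1 ≤ z.re := by rw [h2]; nlinarith
      nlinarith [h.2]
  right
  refine ⟨?_, fun n => ?_⟩
  · rw [abs_of_nonneg h.re_nonneg]
    rcases h with h | h | h
    · rw [h]; simp; positivity
    · have : 1 ≤ 3 * (z.re ^ 2 + z.im ^ 2) := by rw [h.1]; linarith [h.2]
      rw [h.1]
      rw [h.1] at this
      nlinarith
    · exact h.1.le
  · rcases h with h | h | h
    · have : 0 ≤ (n : ℝ) ^ 2 * (z.re ^ 2 + z.im ^ 2) := by positivity
      rw [h] at this h1 ⊢
      linarith
    · have h3 : 1 ≤ 3 * (z.re ^ 2 + z.im ^ 2) := by rw [h.1]; linarith [h.2]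
      generalize z.re ^ 2 + z.im ^ 2 = D at *
      -- For integral `n` the two factors never have opposite signs, because `1/3 ≤ D < 1`.
      have e : 1 + 2 * n * z.re + (n ^ 2 - 1) * D = (n + 1) * (1 + (n - 1) * D) := by
        rw [h.1]; ring
      rw [e]
      rcases lt_trichotomy n (-1) with hn | rfl | hn
      · have hn' : (n : ℝ) ≤ -2 := by exact_mod_cast (by omega : n ≤ -2)
        apply mul_nonneg_of_nonpos_of_nonpos
        · linarith
        · nlinarith
      · simp
      · have hn' : (0 : ℝ) ≤ n := by exact_mod_cast (by omega : 0 ≤ n)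
        apply mul_nonneg
        · linarith
        · nlinarith
    · obtain ⟨h2, h3⟩ := h
      obtain ⟨D, hDdef⟩ : ∃ D, D = z.re ^ 2 + z.im ^ 2 := ⟨_, rfl⟩
      rw [← hDdef] at h1 h2 h3 hD ⊢
      have hx : z.re = p * D / 2 := by linarith
      -- On the arc `(Im z)² = D - p² D²/4`. Completing the square, the expression to bound is `1 +
      -- ((2n + p)² - p² - 4) D/4`, and `(2n + p)² ≥ 1` because `p` is odd.
      have h4 : (p ^ 2 + 3) / 4 * D ≤ 1 := by
        have : ((p : ℝ) ^ 2 + 3) / 4 * D * D ≤ 1 * D := by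
          rw [hx] at hDdef
          linarith
        exact le_of_mul_le_mul_right this hD
      have h5 : (1 : ℝ) ≤ (2 * n + p) ^ 2 := by
        have : (1 : ℤ) ≤ (2 * n + p) ^ 2 := by
          have h0 : (2 * n + (p : ℤ)) ≠ 0 := by omega
          have : 0 < (2 * n + (p : ℤ)) ^ 2 := by positivity
          omega
        exact_mod_cast this
      have h6 := mul_le_mul_of_nonneg_right h5 hD.le
      rw [hx]
      linarith

lemma OnDelta.equiv₀_sigma (hL : 2 * L + 1 = (p : ℤ)) {z : ℍ} (h : OnDelta p z) :
    Equiv₀ p (ofUHP z) (sigma (ofUHP z)) := by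
  rcases h with h | h | h
  · exact equiv₀_sigma_of_re_eq_zero h
  · exact equiv₀_sigma_of_re_eq_half h.1
  · rw [exists_gluingMat_smul_iff hL] at h
    exact Equiv₀.fixed ⟨gluingMat hL, gluingMat_mem hL, moeb_ofUHP _ _⟩
      (equiv₀_sigma_of_re_eq_half h.1)

lemma ofUHP_mem_delta_iff (hp : p.Prime) (hp2 : p ≠ 2) (hL : 2 * L + 1 = (p : ℤ)) (z : ℍ) :
    ofUHP z ∈ delta p ↔ OnDelta p z := by
  rw [delta, mem_fixSet_iff]
  constructor
  · rintro ⟨⟨h1, h2⟩, h3⟩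
    exact onDelta_of_fixed hp hp2 hL h1 (h2 z rfl) h3
  · intro h
    refine ⟨⟨h.mem_Xp hp hp2 hL, fun w hw => ?_⟩, h.equiv₀_sigma hL⟩
    rw [← OnePoint.coe_injective hw]
    exact h.re_nonneg

lemma infty_mem_delta (p : ℕ) : (∞ : Sphere) ∈ delta p :=
  mem_fixSet_iff.2 ⟨⟨infty_mem_Xp p, fun _ hw => absurd hw (OnePoint.infty_ne_coe _)⟩,
    Equiv₀.refl p _⟩

lemma zero_mem_delta (hL : 2 * L + 1 = (p : ℤ)) : ((0 : ℂ) : OnePoint ℂ) ∈ delta p := by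
  refine mem_fixSet_iff.2 ⟨⟨zero_mem_Xp hL, fun w hw => ?_⟩, ?_⟩
  · rw [← OnePoint.coe_injective hw]; simp
  · rw [sigma_zero]; exact Equiv₀.refl p _

lemma mem_delta_iff (hp : p.Prime) (hp2 : p ≠ 2) (hL : 2 * L + 1 = (p : ℤ)) (s : Sphere) :
    s ∈ delta p ↔ s = ∞ ∨ s = ((0 : ℂ) : OnePoint ℂ) ∨ ∃ z : ℍ, OnDelta p z ∧ ofUHP z = s := by
  constructor
  · intro h
    rcases cases_of_mem_Xp hL h.1.1 with rfl | rfl | ⟨z, rfl⟩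
    · exact Or.inl rfl
    · exact Or.inr (Or.inl rfl)
    · exact Or.inr (Or.inr ⟨z, (ofUHP_mem_delta_iff hp hp2 hL z).1 h, rfl⟩)
  · rintro (rfl | rfl | ⟨z, hz, rfl⟩)
    · exact infty_mem_delta p
    · exact zero_mem_delta hL
    · exact (ofUHP_mem_delta_iff hp hp2 hL z).2 hz

lemma delta_subset_fixSet (p : ℕ) :
    delta p ⊆ fixSet (CongruenceSubgroup.Gamma0 p) (Xp p) := fun _ h => ⟨h.1.1, h.2⟩

lemma sigma_mem_fixSet (hL : 2 * L + 1 = (p : ℤ)) {s : Sphere}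
    (h : s ∈ fixSet (CongruenceSubgroup.Gamma0 p) (Xp p)) :
    sigma s ∈ fixSet (CongruenceSubgroup.Gamma0 p) (Xp p) := by
  rw [mem_fixSet_iff] at h ⊢
  exact ⟨sigma_mem_Xp hL h.1, h.2.sigma⟩

lemma mem_delta_or_sigma_mem_delta (hL : 2 * L + 1 = (p : ℤ)) {s : Sphere}
    (h : s ∈ fixSet (CongruenceSubgroup.Gamma0 p) (Xp p)) : s ∈ delta p ∨ sigma s ∈ delta p := by
  rcases cases_of_mem_Xp hL h.1 with rfl | rfl | ⟨z, rfl⟩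
  · exact Or.inl (infty_mem_delta p)
  · exact Or.inl (zero_mem_delta hL)
  · rcases le_total 0 z.re with h0 | h0
    · left
      refine ⟨⟨h.1, fun w hw => ?_⟩, h.2⟩
      rw [← OnePoint.coe_injective hw]
      exact h0
    · right
      have h' := sigma_mem_fixSet hL h
      refine ⟨⟨h'.1, fun w hw => ?_⟩, h'.2⟩
      rw [sigma_ofUHP] at hw
      rw [← OnePoint.coe_injective hw]
      change 0 ≤ -z.re
      linarith

lemma fixSet_eq (hL : 2 * L + 1 = (p : ℤ)) :
    fixSet (CongruenceSubgroup.Gamma0 p) (Xp p) = delta p ∪ sigma '' delta p := by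
  apply Subset.antisymm
  · intro s hs
    rcases mem_delta_or_sigma_mem_delta hL hs with h | h
    · exact Or.inl h
    · exact Or.inr ⟨_, h, sigma_sigma s⟩
  · rintro _ (h | ⟨s, h, rfl⟩)
    · exact delta_subset_fixSet p h
    · exact sigma_mem_fixSet hL (delta_subset_fixSet p h)

/-! ### The vertices -/

lemma sqrt_three_sq : Real.sqrt 3 ^ 2 = 3 := Real.sq_sqrt (by norm_num)

lemma sqrt_three_pos : 0 < Real.sqrt 3 := Real.sqrt_pos.2 (by norm_num)

/-- The vertex `c_1` as a point of the upper half-plane. -/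
noncomputable def vertexOne : ℍ := ⟨⟨1 / 2, Real.sqrt 3 / 6⟩, div_pos sqrt_three_pos (by norm_num)⟩

@[simp] lemma vertexOne_re : vertexOne.re = 1 / 2 := rfl
@[simp] lemma vertexOne_im : vertexOne.im = Real.sqrt 3 / 6 := rfl

lemma eq_vertexOne {z : ℍ} (h1 : z.re = 1 / 2) (h2 : 12 * z.im ^ 2 = 1) : z = vertexOne := by
  apply UpperHalfPlane.ext
  apply Complex.ext
  · exact h1
  · have h3 : (6 * z.im) ^ 2 = Real.sqrt 3 ^ 2 := by rw [sqrt_three_sq]; linarith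
    have hy := z.im_pos
    have := (pow_left_inj₀ (by positivity) sqrt_three_pos.le two_ne_zero).1 h3
    change z.im = Real.sqrt 3 / 6
    linarith

lemma exists_sigma_rho : ∃ w : ℍ, w.re = -1 / 2 ∧ w.im = Real.sqrt 3 / 2 ∧
    sigma rho = ofUHP w := by
  refine ⟨reflect ⟨⟨1 / 2, Real.sqrt 3 / 2⟩, div_pos sqrt_three_pos (by norm_num)⟩,
    ?_, rfl, ?_⟩
  · change -(1 / 2 : ℝ) = _; norm_num
  · rw [← sigma_ofUHP]; rfl

lemma vertex_one : vertex 1 = ofUHP vertexOne := by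
  obtain ⟨w, h1, h2, h3⟩ := exists_sigma_rho
  rw [vertex, h3, moeb_ofUHP]
  congr 1
  rw [alpha_smul_eq_iff, h1, h2, vertexOne_re, vertexOne_im, div_pow, div_pow, sqrt_three_sq]
  constructor <;> push_cast <;> ring

/-- This places `c_L` at the end of the boundary arc and shows that it is glued to `c_1`. -/
lemma vertex_eq (hL : 2 * L + 1 = (p : ℤ)) :
    ∃ z : ℍ, vertex L = ofUHP z ∧ gluingMat hL • z = vertexOne := by
  obtain ⟨w, h1, h2, h3⟩ := exists_sigma_rho
  have hLR : 2 * (L : ℝ) + 1 = p := by exact_mod_cast hL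
  refine ⟨alpha L • w, by rw [vertex, h3, moeb_ofUHP], ?_⟩
  obtain ⟨e1, e2⟩ := (alpha_smul_eq_iff L w _).1 rfl
  rw [gluingMat_smul_eq_iff hL vertexOne_re, vertexOne_im]
  rw [h1] at e1
  rw [h2] at e2
  constructor
  · linear_combination 2 * e1 + ((alpha L • w).re ^ 2 + (alpha L • w).im ^ 2) * hLR
  · linear_combination (-4 * Real.sqrt 3 / 6) * e2 +
      ((alpha L • w).re ^ 2 + (alpha L • w).im ^ 2) / 3 * sqrt_three_sq

lemma vertex_eq_moeb (hL : 2 * L + 1 = (p : ℤ)) :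
    vertex L = ofUHP ((gluingMat hL)⁻¹ • vertexOne) := by
  obtain ⟨z, h1, h2⟩ := vertex_eq hL
  rw [h1, ← h2, inv_smul_smul]

lemma equiv₀_vertex (hL : 2 * L + 1 = (p : ℤ)) : Equiv₀ p (vertex L) (vertex 1) := by
  obtain ⟨z, h1, h2⟩ := vertex_eq hL
  exact ⟨gluingMat hL, gluingMat_mem hL, by rw [h1, vertex_one, moeb_ofUHP, h2]⟩

lemma not_equiv₀_infty_ofUHP (z : ℍ) : ¬ Equiv₀ p ∞ (ofUHP z) := by
  rintro ⟨γ, -, h⟩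
  exact ofUHP_ne_infty _ (exists_smul_of_moeb h).symm

lemma not_equiv₀_zero_ofUHP (z : ℍ) : ¬ Equiv₀ p ((0 : ℂ) : OnePoint ℂ) (ofUHP z) := by
  rintro ⟨γ, -, h⟩
  exact zero_ne_ofUHP _ (exists_smul_of_moeb h)

lemma not_equiv₀_infty_zero (hp : p.Prime) : ¬ Equiv₀ p ∞ ((0 : ℂ) : OnePoint ℂ) := by
  rintro ⟨γ, hγ, h⟩
  rw [mem_Gamma0_iff] at hγ
  rw [moeb_infty] at h
  split_ifs at h with hc
  · exact OnePoint.infty_ne_coe _ h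
  · have h0 := OnePoint.coe_injective h
    rw [div_eq_zero_iff] at h0
    have ha : γ 0 0 = 0 := by
      rcases h0 with h0 | h0
      · exact_mod_cast h0
      · exact absurd (by exact_mod_cast h0) hc
    have hdet := det_eq_one γ
    rw [ha] at hdet
    have : (p : ℤ) ∣ 1 := by
      rw [← hdet]
      simpa using hγ.mul_left (γ 0 1)
    exact (Nat.prime_iff_prime_int.1 hp).not_dvd_one this

/-- Carry points of the boundary arc to `Re = 1/2` by `gluingMat`; both points are then on the two
lines, so they coincide. The transported arc and the upper half-line share only `c_1`. -/
lemma eq_or_eq_of_equiv₀ (hp : p.Prime) (hp2 : p ≠ 2) (hL : 2 * L + 1 = (p : ℤ)) {z w : ℍ}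
    (hz : OnDelta p z) (hw : OnDelta p w) (h : Equiv₀ p (ofUHP z) (ofUHP w)) :
    z = w ∨ (z = (gluingMat hL)⁻¹ • vertexOne ∧ w = vertexOne) ∨
      (z = vertexOne ∧ w = (gluingMat hL)⁻¹ • vertexOne) := by
  have hglue : ∀ z : ℍ, Equiv₀ p (ofUHP z) (ofUHP (gluingMat hL • z)) := fun z =>
    ⟨gluingMat hL, gluingMat_mem hL, moeb_ofUHP _ _⟩
  have key : ∀ z w : ℍ, (z.re = 0 ∨ (z.re = 1 / 2 ∧ 1 ≤ 12 * z.im ^ 2)) →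
      ((gluingMat hL • w).re = 1 / 2 ∧ 12 * (gluingMat hL • w).im ^ 2 ≤ 1) →
      Equiv₀ p (ofUHP z) (ofUHP w) →
      z = vertexOne ∧ w = (gluingMat hL)⁻¹ • vertexOne := by
    intro z w hz hw h
    have e := eq_of_equiv₀_of_lines hp hp2 (hz.imp_right And.left) (Or.inr hw.1)
      (h.trans (hglue w))
    rw [eq_inv_smul_iff]
    rw [← e] at hw ⊢
    have : z = vertexOne := by
      rcases hz with hz | hz
      · rw [hz] at hw; norm_num at hw
      · exact eq_vertexOne hz.1 (le_antisymm hw.2 hz.2)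
    exact ⟨this, this⟩
  rw [OnDelta, ← or_assoc, exists_gluingMat_smul_iff hL] at hz hw
  rcases hz with hz | hz <;> rcases hw with hw | hw
  · exact Or.inl (eq_of_equiv₀_of_lines hp hp2 (hz.imp_right And.left)
      (hw.imp_right And.left) h)
  · exact Or.inr (Or.inr (key z w hz hw h))
  · exact Or.inr (Or.inl (key w z hw hz h.symm).symm)
  · left
    exact smul_left_cancel _ (eq_of_equiv₀_of_lines hp hp2 (Or.inr hz.1) (Or.inr hw.1)
      (((hglue z).symm.trans h).trans (hglue w)))

lemma equiv₀_iff_of_mem_delta (hp : p.Prime) (hp2 : p ≠ 2) (hL : 2 * L + 1 = (p : ℤ))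
    {z w : Sphere} (hz : z ∈ delta p) (hw : w ∈ delta p) : Equiv₀ p z w ↔
      z = w ∨ (z = vertex L ∧ w = vertex 1) ∨ (z = vertex 1 ∧ w = vertex L) := by
  constructor
  · intro h
    rcases (mem_delta_iff hp hp2 hL z).1 hz with rfl | rfl | ⟨z, hz', rfl⟩ <;>
    rcases (mem_delta_iff hp hp2 hL w).1 hw with rfl | rfl | ⟨w, hw', rfl⟩
    · exact Or.inl rfl
    · exact absurd h (not_equiv₀_infty_zero hp)
    · exact absurd h (not_equiv₀_infty_ofUHP w)
    · exact absurd h.symm (not_equiv₀_infty_zero hp)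
    · exact Or.inl rfl
    · exact absurd h (not_equiv₀_zero_ofUHP w)
    · exact absurd h.symm (not_equiv₀_infty_ofUHP z)
    · exact absurd h.symm (not_equiv₀_zero_ofUHP z)
    · rw [vertex_one, vertex_eq_moeb hL]
      simp only [ofUHP_injective.eq_iff]
      exact eq_or_eq_of_equiv₀ hp hp2 hL hz' hw' h
  · rintro (rfl | ⟨rfl, rfl⟩ | ⟨rfl, rfl⟩)
    · exact Equiv₀.refl p z
    · exact equiv₀_vertex hL
    · exact (equiv₀_vertex hL).symm

end


/-! ### Paths and closed curves -/

section
variable {X : Type*} [TopologicalSpace X]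

/-- `A` is traced by an injective path from `a` to `b`. -/
def IsArc (a b : X) (A : Set X) : Prop :=
  ∃ h : Path a b, Function.Injective h ∧ range h = A

lemma IsArc.symm {a b : X} {A : Set X} (h : IsArc a b A) : IsArc b a A := by
  obtain ⟨h, hinj, rfl⟩ := h
  refine ⟨h.symm, fun s t hst => ?_, Path.symm_range h⟩
  exact unitInterval.symm_bijective.injective (hinj hst)

lemma IsGeodesicArc.isArc {a b : Sphere} {A : Set Sphere} (h : IsGeodesicArc a b A) :
    IsArc a b A := by
  obtain ⟨h, h1, h2, -⟩ := h
  exact ⟨h, h1, h2⟩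

lemma IsSimpleCurve.isArc {a b : X} {A : Set X} (h : IsSimpleCurve a b A) (hab : a ≠ b) :
    IsArc a b A := by
  obtain ⟨h, hr, hs⟩ := h
  have key : ∀ s t : unitInterval, s < t → h s ≠ h t := by
    intro s t hst he
    obtain ⟨rfl, rfl⟩ := hs s t hst he
    rw [h.source, h.target] at he
    exact hab he
  refine ⟨h, fun s t hst => ?_, hr⟩
  rcases lt_trichotomy s t with h1 | h1 | h1
  · exact absurd hst (key s t h1)
  · exact h1
  · exact absurd hst.symm (key t s h1)

/-- The second alternative in the hypothesis lets the outer end points coincide, as happens for `p =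
3`. -/
lemma IsArc.union {a b c : X} {A B : Set X} (hA : IsArc a b A) (hB : IsArc b c B)
    (h : ∀ x ∈ A, x ∈ B → x = b ∨ (x = a ∧ x = c)) : IsSimpleCurve a c (A ∪ B) := by
  obtain ⟨f, hf, rfl⟩ := hA
  obtain ⟨g, hg, rfl⟩ := hB
  refine ⟨f.trans g, Path.trans_range f g, fun s t hst he => ?_⟩
  rw [Path.trans_apply, Path.trans_apply] at he
  have hst' : (s : ℝ) < t := hst
  split_ifs at he with h1 h2 h2
  · have := congrArg Subtype.val (hf he)
    simp at this
    exact absurd this hst'.ne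
  · have hs := h _ ⟨_, rfl⟩ ⟨_, he.symm⟩
    rcases hs with hs | ⟨hs, hs'⟩
    · have e1 := congrArg Subtype.val (hf (hs.trans f.target.symm))
      have e2 := congrArg Subtype.val (hg ((he.symm.trans hs).trans g.source.symm))
      simp at e1 e2
      linarith
    · have e1 := congrArg Subtype.val (hf (hs.trans f.source.symm))
      have e2 := congrArg Subtype.val (hg ((he.symm.trans hs').trans g.target.symm))
      simp at e1 e2
      exact ⟨Subtype.ext (by simpa using e1), Subtype.ext (by rw [Icc.coe_one]; linarith)⟩
  · linarith
  · have := congrArg Subtype.val (hg he)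
    simp at this
    exact absurd this hst'.ne

/-- Closedness of `g` replaces the usual compact-to-Hausdorff argument, so that the target can be
the glued surface. -/
lemma isSimpleClosedCurve_range {g : unitInterval → X} (hc : Continuous g) (h01 : g 0 = g 1)
    (hinj : ∀ s t : unitInterval, s < t → g s = g t → s = 0 ∧ t = 1) (hcl : IsClosedMap g) :
    IsSimpleClosedCurve (range g) := by
  have : Fact (0 < (1 : ℝ)) := ⟨one_pos⟩
  set F : ℝ → X := fun t => g (projIcc 0 1 zero_le_one t) with hF
  set f : AddCircle (1 : ℝ) → X := AddCircle.liftIco 1 0 F with hf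
  have hF01 : F 0 = F (0 + 1) := by simpa [hF] using h01
  have hfc : Continuous f := AddCircle.liftIco_continuous hF01
    (hc.comp continuous_projIcc).continuousOn
  have hfq : ∀ t : unitInterval, f ((t : ℝ) : AddCircle (1 : ℝ)) = g t := by
    intro t
    by_cases ht : t = 1
    · subst ht
      have : ((1 : ℝ) : AddCircle (1 : ℝ)) = ((0 : ℝ) : AddCircle (1 : ℝ)) := by
        rw [AddCircle.coe_period]; rfl
      rw [Icc.coe_one, this, hf, AddCircle.liftIco_coe_apply (by simp)]
      simpa [hF] using h01
    · have ht1 : (t : ℝ) < 1 := unitInterval.lt_one_iff_ne_one.2 ht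
      rw [hf, AddCircle.liftIco_coe_apply ⟨t.2.1, by simpa using ht1⟩]
      simp [hF]
  have hq : Continuous fun t : unitInterval => ((t : ℝ) : AddCircle (1 : ℝ)) :=
    (AddCircle.continuous_mk' 1).comp continuous_subtype_val
  have hsurj : ∀ x : AddCircle (1 : ℝ), ∃ t : unitInterval,
      t ≠ 1 ∧ ((t : ℝ) : AddCircle (1 : ℝ)) = x := by
    intro x
    have hx : x ∈ ((↑) : ℝ → AddCircle (1 : ℝ)) '' Ico 0 (0 + 1) := by
      rw [AddCircle.coe_image_Ico_eq]; trivial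
    obtain ⟨t, ht, rfl⟩ := hx
    rw [zero_add] at ht
    exact ⟨⟨t, ht.1, ht.2.le⟩, unitInterval.lt_one_iff_ne_one.1 ht.2, rfl⟩
  have hfinj : Function.Injective f := by
    intro x y hxy
    obtain ⟨s, hs, rfl⟩ := hsurj x
    obtain ⟨t, ht, rfl⟩ := hsurj y
    rw [hfq, hfq] at hxy
    rcases lt_trichotomy s t with h | h | h
    · exact absurd (hinj s t h hxy).2 ht
    · rw [h]
    · exact absurd (hinj t s h hxy.symm).2 hs
  have hfcl : IsClosedMap f := by
    intro C hC
    have : f '' C = g '' ((fun t : unitInterval => ((t : ℝ) : AddCircle (1 : ℝ))) ⁻¹' C) := by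
      ext y
      constructor
      · rintro ⟨x, hx, rfl⟩
        obtain ⟨t, -, rfl⟩ := hsurj x
        exact ⟨t, hx, (hfq t).symm⟩
      · rintro ⟨t, ht, rfl⟩
        exact ⟨_, ht, hfq t⟩
    rw [this]
    exact hcl _ (hC.preimage hq)
  let e := AddCircle.homeomorphCircle (T := (1 : ℝ)) one_ne_zero
  refine ⟨f ∘ e.symm, ?_, ?_⟩
  · exact (IsClosedEmbedding.of_continuous_injective_isClosedMap hfc hfinj
      hfcl).isEmbedding.comp e.symm.isEmbedding
  · rw [e.symm.surjective.range_comp]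
    ext y
    constructor
    · rintro ⟨x, rfl⟩
      obtain ⟨t, -, rfl⟩ := hsurj x
      exact ⟨t, (hfq t).symm⟩
    · rintro ⟨t, rfl⟩
      exact ⟨_, hfq t⟩

/-- The point of the sphere with homogeneous coordinates `(n : d)`. -/
noncomputable def ratio (n d : ℂ) : Sphere := if d = 0 then ∞ else ((n / d : ℂ) : OnePoint ℂ)

/-- Where `d` vanishes, `‖n‖` eventually exceeds `R ‖d‖` for every `R`, so the quotient leaves every
compact set. Paths through a cusp at infinity are thereby continuous. -/
lemma continuous_ratio {n d : X → ℂ} (hn : Continuous n) (hd : Continuous d)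
    (h : ∀ x, d x = 0 → n x ≠ 0) : Continuous fun x => ratio (n x) (d x) := by
  rw [continuous_iff_continuousAt]
  intro x
  by_cases hx : d x = 0
  · have e : ratio (n x) (d x) = ∞ := if_pos hx
    rw [ContinuousAt, e]
    rw [Tendsto, OnePoint.le_nhds_infty]
    intro s _ hs
    obtain ⟨R, hR⟩ := hs.isBounded.exists_norm_le
    have hev : ∀ᶠ y in 𝓝 x, R * ‖d y‖ < ‖n y‖ := by
      have h1 : ContinuousAt (fun y => R * ‖d y‖) x := by fun_prop
      have h2 : ContinuousAt (fun y => ‖n y‖) x := by fun_prop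
      apply h1.eventually_lt h2
      rw [hx, norm_zero, mul_zero]
      exact norm_pos_iff.2 (h x hx)
    rw [Filter.mem_map]
    filter_upwards [hev] with y hy
    by_cases hdy : d y = 0
    · exact Or.inr (if_pos hdy)
    · refine Or.inl ⟨n y / d y, fun hw => ?_, (if_neg hdy).symm⟩
      have h3 := hR _ hw
      rw [norm_div, div_le_iff₀ (norm_pos_iff.2 hdy)] at h3
      linarith
  · have hev : (fun y => ((n y / d y : ℂ) : OnePoint ℂ)) =ᶠ[𝓝 x]
        fun y => ratio (n y) (d y) := by
      filter_upwards [hd.continuousAt.eventually_ne hx] with y hy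
      exact (if_neg hy).symm
    refine ContinuousAt.congr ?_ hev
    exact OnePoint.continuous_coe.continuousAt.comp
      (hn.continuousAt.div hd.continuousAt hx)

end


/-! ### Geodesics -/

lemma dist_smul_smul (g : SL(2, ℤ)) (x y : ℍ) : dist (g • x) (g • y) = dist x y :=
  dist_smul (g : SL(2, ℝ)) x y

/-- Distance on a vertical line is the difference of the logarithms of the heights; `g` transports
this to any geodesic it makes vertical. -/
lemma dist_add_of_vertical (g : SL(2, ℤ)) {x y z : ℍ} (hxy : (g • x).re = (g • y).re)
    (hyz : (g • y).re = (g • z).re) (hxy' : (g • x).im ≤ (g • y).im)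
    (hyz' : (g • y).im ≤ (g • z).im) : dist x z = dist x y + dist y z := by
  rw [← dist_smul_smul g x z, ← dist_smul_smul g x y, ← dist_smul_smul g y z,
    UpperHalfPlane.dist_of_re_eq (hxy.trans hyz), UpperHalfPlane.dist_of_re_eq hxy,
    UpperHalfPlane.dist_of_re_eq hyz]
  have h1 := Real.log_le_log (UpperHalfPlane.im_pos _) hxy'
  have h2 := Real.log_le_log (UpperHalfPlane.im_pos _) hyz'
  rw [Real.dist_eq, Real.dist_eq, Real.dist_eq, abs_of_nonpos (by linarith),
    abs_of_nonpos (by linarith), abs_of_nonpos (by linarith)]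
  ring

lemma ofUHP_re_im {x y : ℝ} (hy : 0 < y) :
    ((⟨x, y⟩ : ℂ) : OnePoint ℂ) = ofUHP ⟨⟨x, y⟩, hy⟩ := rfl

/-- The vertical geodesic arc from `r + i α` to the cusp at infinity. -/
lemma isGeodesicArc_vertical (r : ℝ) {α β : ℝ} (hα : 0 ≤ α) (hβ : 0 ≤ β) (hαβ : 0 < α + β) :
    IsGeodesicArc ((⟨r, α⟩ : ℂ) : OnePoint ℂ) ∞
      (insert ∞ ((fun y : ℝ => ((⟨r, y⟩ : ℂ) : OnePoint ℂ)) '' Ici α)) := by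
  -- The height is `(α + β t)/(1 - t)`, a Möbius map of `[0, 1]` onto `[α, ∞]` of determinant `α +
  -- β`. The parameter `β` serves both a start at the real line (`α = 0`, `β = 1`) and one inside
  -- (`β = 0`).
  set f : unitInterval → Sphere := fun t =>
    ratio ⟨(1 - t) * r, α + β * t⟩ ((1 - t : ℝ) : ℂ) with hf
  have hf1 : f 1 = ∞ := by simp [hf, ratio]
  have hflt : ∀ t : unitInterval, (t : ℝ) < 1 →
      f t = ((⟨r, (α + β * t) / (1 - t)⟩ : ℂ) : OnePoint ℂ) := by
    intro t ht
    have h1 : (1 : ℝ) - t ≠ 0 := by linarith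
    rw [hf]
    dsimp only
    rw [ratio, if_neg (by exact_mod_cast h1)]
    congr 1
    apply Complex.ext
    · rw [Complex.div_ofReal_re]; field_simp
    · rw [Complex.div_ofReal_im]
  have hcont : Continuous f := by
    apply continuous_ratio
    · have : (fun t : unitInterval => (⟨(1 - t) * r, α + β * t⟩ : ℂ)) =
        fun t : unitInterval => (((1 - t) * r : ℝ) : ℂ) + ((α + β * t : ℝ) : ℂ) * Complex.I := by
        funext t
        exact Complex.mk_eq_add_mul_I _ _
      rw [this]
      fun_prop
    · fun_prop
    · intro t ht h
      have h1 : (1 : ℝ) - t = 0 := by exact_mod_cast ht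
      have h2 : α + β * t = 0 := congrArg Complex.im h
      rw [show (t : ℝ) = 1 by linarith] at h2
      linarith
  have hcases : ∀ t : unitInterval, t = 1 ∨ (t : ℝ) < 1 := fun t => by
    rcases eq_or_lt_of_le t.2.2 with h | h
    · exact Or.inl (Subtype.ext h)
    · exact Or.inr h
  have hpos : ∀ t : unitInterval, 0 < t → (t : ℝ) < 1 → 0 < (α + β * t) / (1 - t) := by
    intro t h0 h1
    have h0' : (0 : ℝ) < t := h0
    apply div_pos _ (by linarith)
    rcases hα.eq_or_lt with h | h
    · have : 0 < β := by linarith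
      positivity
    · positivity
  have hmono : ∀ s t : unitInterval, s ≤ t → (t : ℝ) < 1 →
      (α + β * s) / (1 - s) ≤ (α + β * t) / (1 - t) := by
    intro s t hst h1
    have hst' : (s : ℝ) ≤ t := hst
    rw [div_le_div_iff₀ (by linarith) (by linarith)]
    nlinarith
  refine ⟨⟨⟨f, hcont⟩, ?_, hf1⟩, ?_, ?_, ?_, ?_⟩
  · change f 0 = _
    rw [hflt 0 (by simp)]
    simp
  · intro s t (hst : f s = f t)
    rcases hcases s with rfl | hs <;> rcases hcases t with rfl | ht
    · rfl
    · rw [hf1, hflt t ht] at hst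
      exact absurd hst (OnePoint.infty_ne_coe _)
    · rw [hf1, hflt s hs] at hst
      exact absurd hst (OnePoint.coe_ne_infty _)
    · rw [hflt s hs, hflt t ht] at hst
      have h1 := congrArg Complex.im (OnePoint.coe_injective hst)
      dsimp only at h1
      rw [div_eq_div_iff (by linarith) (by linarith)] at h1
      apply Subtype.ext
      apply mul_left_cancel₀ hαβ.ne'
      linarith
  · change range f = _
    ext x
    constructor
    · rintro ⟨t, rfl⟩
      rcases hcases t with rfl | ht
      · exact Or.inl hf1
      · refine Or.inr ⟨_, ?_, (hflt t ht).symm⟩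
        have := hmono 0 t t.2.1 ht
        simpa using this
    · rintro (rfl | ⟨y, hy, rfl⟩)
      · exact ⟨1, hf1⟩
      · have hy' : α ≤ y := hy
        have hyβ : 0 < y + β := by linarith
        have h1 : (y - α) / (y + β) < 1 := by rw [div_lt_one hyβ]; linarith
        refine ⟨⟨(y - α) / (y + β), div_nonneg (by linarith) hyβ.le, h1.le⟩, ?_⟩
        rw [hflt _ h1]
        congr 2
        dsimp only
        have : 1 - (y - α) / (y + β) ≠ 0 := by linarith
        rw [div_eq_iff this]
        field_simp
        ring
  · intro t h0 h1
    change f t ∈ _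
    rw [hflt t h1, ofUHP_re_im (hpos t h0 h1)]
    exact ⟨_, rfl⟩
  · intro s t u x y z hst htu hx hy hz
    have key : ∀ (t : unitInterval) (w : ℍ), f t = ofUHP w →
        (t : ℝ) < 1 ∧ w.re = r ∧ w.im = (α + β * t) / (1 - t) := by
      intro t w h
      rcases hcases t with rfl | ht
      · rw [hf1] at h
        exact absurd h.symm (ofUHP_ne_infty w)
      · rw [hflt t ht] at h
        have h' := OnePoint.coe_injective h
        exact ⟨ht, (congrArg Complex.re h').symm, (congrArg Complex.im h').symm⟩
    obtain ⟨-, hx1, hx2⟩ := key s x hx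
    obtain ⟨ht, hy1, hy2⟩ := key t y hy
    obtain ⟨hu, hz1, hz2⟩ := key u z hz
    apply dist_add_of_vertical 1 <;> simp only [one_smul]
    · rw [hx1, hy1]
    · rw [hy1, hz1]
    · rw [hx2, hy2]
      exact hmono s t hst ht
    · rw [hy2, hz2]
      exact hmono t u htu hu

/-- The image under a matrix of a vertical geodesic arc starting at the real line. -/
lemma isGeodesicArc_moeb_vertical (g : SL(2, ℤ)) (r : ℝ) {β : ℝ} (hβ : 0 < β) :
    IsGeodesicArc (moeb g ((r : ℂ) : OnePoint ℂ)) (moeb g ((⟨r, β⟩ : ℂ) : OnePoint ℂ))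
      (moeb g '' ((fun y : ℝ => ((⟨r, y⟩ : ℂ) : OnePoint ℂ)) '' Icc 0 β)) := by
  set c : unitInterval → ℂ := fun t => ⟨r, β * t⟩ with hc
  have hcc : Continuous c := by
    have : c = fun t : unitInterval => (r : ℂ) + ((β * t : ℝ) : ℂ) * Complex.I := by
      funext t
      exact Complex.mk_eq_add_mul_I _ _
    rw [this]
    fun_prop
  set f : unitInterval → Sphere := fun t => moeb g (c t : OnePoint ℂ) with hf
  have hcont : Continuous f := by
    have : f = fun t => ratio ((g 0 0 : ℂ) * c t + g 0 1) ((g 1 0 : ℂ) * c t + g 1 1) := by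
      funext t
      exact moeb_some g (c t)
    rw [this]
    -- Numerator and denominator cannot vanish together, since `g` is invertible.
    apply continuous_ratio (by fun_prop) (by fun_prop)
    intro t ht h
    have hdet : ((g 0 0 : ℂ) * g 1 1 - g 0 1 * g 1 0) = 1 := by exact_mod_cast det_eq_one g
    have : (1 : ℂ) = 0 := by
      linear_combination (-1 : ℂ) * hdet + (g 0 0 : ℂ) * ht - (g 1 0 : ℂ) * h
    exact one_ne_zero this
  have hcpos : ∀ t : unitInterval, 0 < t → 0 < β * t := fun t h0 => mul_pos hβ h0
  refine ⟨⟨⟨f, hcont⟩, ?_, ?_⟩, ?_, ?_, ?_, ?_⟩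
  · change moeb g (c 0 : OnePoint ℂ) = _
    congr 2
    apply Complex.ext <;> simp [hc]
  · change moeb g (c 1 : OnePoint ℂ) = _
    simp [hc]
  · intro s t (hst : f s = f t)
    have h := congrArg Complex.im (OnePoint.coe_injective (moeb_injective g hst))
    exact Subtype.ext (mul_left_cancel₀ hβ.ne' h)
  · change range f = _
    ext x
    constructor
    · rintro ⟨t, rfl⟩
      refine ⟨_, ⟨β * t, ⟨mul_nonneg hβ.le t.2.1, ?_⟩, rfl⟩, rfl⟩
      exact mul_le_of_le_one_right hβ.le t.2.2
    · rintro ⟨_, ⟨y, hy, rfl⟩, rfl⟩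
      refine ⟨⟨y / β, div_nonneg hy.1 hβ.le, (div_le_one hβ).2 hy.2⟩, ?_⟩
      simp only [hf, hc]
      rw [mul_div_cancel₀ _ hβ.ne']
  · intro t h0 _
    change moeb g ((⟨r, β * t⟩ : ℂ) : OnePoint ℂ) ∈ _
    rw [ofUHP_re_im (hcpos t h0), moeb_ofUHP]
    exact ⟨_, rfl⟩
  · intro s t u x y z hst htu hx hy hz
    have key : ∀ (t : unitInterval) (w : ℍ), f t = ofUHP w →
        (g⁻¹ • w).re = r ∧ (g⁻¹ • w).im = β * t := by
      intro t w h
      have h' := OnePoint.coe_injective (exists_smul_of_moeb h)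
      exact ⟨(congrArg Complex.re h').symm, (congrArg Complex.im h').symm⟩
    obtain ⟨hx1, hx2⟩ := key s x hx
    obtain ⟨hy1, hy2⟩ := key t y hy
    obtain ⟨hz1, hz2⟩ := key u z hz
    apply dist_add_of_vertical g⁻¹
    · rw [hx1, hy1]
    · rw [hy1, hz1]
    · rw [hx2, hy2]
      exact mul_le_mul_of_nonneg_left hst hβ.le
    · rw [hy2, hz2]
      exact mul_le_mul_of_nonneg_left htu hβ.le

lemma isCompleteGeodesic_verticalLine (r : ℝ) :
    IsCompleteGeodesic ((r : ℂ) : OnePoint ℂ) ∞ (verticalLine r) := by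
  set f : ℝ → ℍ := fun t => ⟨⟨r, Real.exp t⟩, Real.exp_pos t⟩ with hf
  have hcoe : ∀ t, ((f t : ℍ) : ℂ) = (r : ℂ) + ((Real.exp t : ℝ) : ℂ) * Complex.I := fun t =>
    Complex.mk_eq_add_mul_I _ _
  refine ⟨f, ?_, ?_, ?_, ?_⟩
  · apply Isometry.of_dist_eq
    intro s t
    rw [UpperHalfPlane.dist_of_re_eq (z := f s) (w := f t) rfl]
    change dist (Real.log (Real.exp s)) (Real.log (Real.exp t)) = _
    rw [Real.log_exp, Real.log_exp]
  · ext x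
    constructor
    · rintro ⟨t, rfl⟩
      exact ⟨f t, rfl, rfl⟩
    · rintro ⟨z, hz, rfl⟩
      refine ⟨Real.log z.im, ?_⟩
      apply congrArg ofUHP
      apply UpperHalfPlane.ext
      apply Complex.ext
      · exact hz.symm
      · exact Real.exp_log z.im_pos
  · apply (OnePoint.continuous_coe.tendsto _).comp
    have h1 : Tendsto (fun t : ℝ => (r : ℂ) + ((Real.exp t : ℝ) : ℂ) * Complex.I) atBot
        (𝓝 ((r : ℂ) + ((0 : ℝ) : ℂ) * Complex.I)) :=
      tendsto_const_nhds.add (((Complex.continuous_ofReal.tendsto 0).comp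
        Real.tendsto_exp_atBot).mul_const _)
    simpa [hcoe] using h1
  · apply OnePoint.tendsto_coe_infty.comp
    rw [coclosedCompact_eq_cocompact, ← Metric.cobounded_eq_cocompact,
      ← tendsto_norm_atTop_iff_cobounded]
    refine tendsto_atTop_mono (fun t => ?_) Real.tendsto_exp_atTop
    have := Complex.abs_im_le_norm ((f t : ℍ) : ℂ)
    exact (le_abs_self _).trans this


/-! ### The fixed curve -/

section
variable {p : ℕ} {L : ℤ}

/-- The arc of the fixed curve from the cusp `0` to the cusp at infinity. -/
def axisArc : Set Sphere := {((0 : ℂ) : OnePoint ℂ), ∞} ∪ verticalLine 0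

/-- The arc of the fixed curve from the cusp `0` to the lower vertex. -/
def lowerArc (p : ℕ) : Set Sphere :=
  {s | s = ((0 : ℂ) : OnePoint ℂ) ∨ ∃ z : ℍ, (2 * z.re = p * (z.re ^ 2 + z.im ^ 2) ∧
    3 * (z.re ^ 2 + z.im ^ 2) ^ 2 ≤ 4 * z.im ^ 2) ∧ ofUHP z = s}

/-- The arc of the fixed curve from the vertex `c_1` to the cusp at infinity. -/
def halfArc : Set Sphere :=
  {s | s = ∞ ∨ ∃ z : ℍ, (z.re = 1 / 2 ∧ 1 ≤ 12 * z.im ^ 2) ∧ ofUHP z = s}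

lemma re_im_eq_ofUHP {z : ℍ} {r : ℝ} (h : z.re = r) :
    ((⟨r, z.im⟩ : ℂ) : OnePoint ℂ) = ofUHP z := by
  subst h; rfl

lemma isGeodesicArc_axisArc : IsGeodesicArc ((0 : ℂ) : OnePoint ℂ) ∞ axisArc := by
  have h := isGeodesicArc_vertical 0 (α := 0) (β := 1) le_rfl zero_le_one (by norm_num)
  suffices e : axisArc = _ from e ▸ h
  ext s
  constructor
  · rintro ((rfl | rfl) | ⟨z, hz, rfl⟩)
    · exact Or.inr ⟨0, self_mem_Ici, rfl⟩
    · exact Or.inl rfl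
    · refine Or.inr ⟨z.im, z.im_pos.le, ?_⟩
      exact re_im_eq_ofUHP hz
  · rintro (rfl | ⟨y, hy, rfl⟩)
    · exact Or.inl (Or.inr rfl)
    · rcases (show (0 : ℝ) ≤ y from hy).eq_or_lt with rfl | hy
      · exact Or.inl (Or.inl rfl)
      · exact Or.inr ⟨⟨⟨0, y⟩, hy⟩, rfl, rfl⟩

lemma sqrt_three_div_le_iff {y : ℝ} (hy : 0 ≤ y) : Real.sqrt 3 / 6 ≤ y ↔ 1 ≤ 12 * y ^ 2 := by
  rw [div_le_iff₀ (by norm_num), Real.sqrt_le_left (by positivity)]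
  constructor <;> intro h <;> linarith

lemma le_sqrt_three_div_iff {y : ℝ} (hy : 0 ≤ y) : y ≤ Real.sqrt 3 / 6 ↔ 12 * y ^ 2 ≤ 1 := by
  rw [le_div_iff₀ (by norm_num), Real.le_sqrt (by positivity) (by norm_num)]
  constructor <;> intro h <;> linarith

lemma isGeodesicArc_halfArc : IsGeodesicArc (vertex 1) ∞ halfArc := by
  have h := isGeodesicArc_vertical (1 / 2) (α := Real.sqrt 3 / 6) (β := 0)
    (by positivity) le_rfl (by have := sqrt_three_pos; positivity)
  rw [vertex_one]
  suffices e : halfArc = _ from e ▸ h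
  ext s
  constructor
  · rintro (rfl | ⟨z, hz, rfl⟩)
    · exact Or.inl rfl
    · exact Or.inr ⟨z.im, (sqrt_three_div_le_iff z.im_pos.le).2 hz.2,
        re_im_eq_ofUHP hz.1⟩
  · rintro (rfl | ⟨y, hy, rfl⟩)
    · exact Or.inl rfl
    · have hy' : Real.sqrt 3 / 6 ≤ y := hy
      have hy0 : 0 < y := lt_of_lt_of_le (div_pos sqrt_three_pos (by norm_num)) hy'
      exact Or.inr ⟨⟨⟨1 / 2, y⟩, hy0⟩, ⟨rfl, (sqrt_three_div_le_iff hy0.le).1 hy'⟩, rfl⟩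

lemma moeb_inv_gluingMat_half (hL : 2 * L + 1 = (p : ℤ)) :
    moeb (gluingMat hL)⁻¹ (((1 / 2 : ℝ) : ℂ) : OnePoint ℂ) = ((0 : ℂ) : OnePoint ℂ) := by
  have h : moeb (gluingMat hL) ((0 : ℂ) : OnePoint ℂ) = (((1 / 2 : ℝ) : ℂ) : OnePoint ℂ) := by
    rw [moeb_some]
    simp [gluingMat]
  rw [← h, moeb_inv_moeb]

lemma isGeodesicArc_lowerArc (hL : 2 * L + 1 = (p : ℤ)) :
    IsGeodesicArc ((0 : ℂ) : OnePoint ℂ) (vertex L) (lowerArc p) := by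
  have h := isGeodesicArc_moeb_vertical (gluingMat hL)⁻¹ (1 / 2)
    (β := Real.sqrt 3 / 6) (div_pos sqrt_three_pos (by norm_num))
  rw [moeb_inv_gluingMat_half hL] at h
  rw [vertex_eq_moeb hL, ← moeb_ofUHP]
  suffices e : lowerArc p = _ from e ▸ h
  ext s
  constructor
  · rintro (rfl | ⟨z, hz, rfl⟩)
    · exact ⟨((⟨1 / 2, 0⟩ : ℂ) : OnePoint ℂ), mem_image_of_mem _ ⟨le_rfl, by positivity⟩,
        moeb_inv_gluingMat_half hL⟩
    · rw [exists_gluingMat_smul_iff hL] at hz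
      have hpos := (gluingMat hL • z).im_pos
      refine ⟨ofUHP (gluingMat hL • z), ⟨(gluingMat hL • z).im,
        ⟨hpos.le, (le_sqrt_three_div_iff hpos.le).2 hz.2⟩, re_im_eq_ofUHP hz.1⟩, ?_⟩
      rw [moeb_ofUHP, inv_smul_smul]
  · rintro ⟨_, ⟨y, ⟨hy0, hy⟩, rfl⟩, rfl⟩
    rcases hy0.eq_or_lt with rfl | hy0
    · exact Or.inl (moeb_inv_gluingMat_half hL)
    · right
      obtain ⟨w, hwre, hwim⟩ : ∃ w : ℍ, w.re = 1 / 2 ∧ w.im = y := ⟨⟨⟨1 / 2, y⟩, hy0⟩, rfl, rfl⟩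
      refine ⟨(gluingMat hL)⁻¹ • w, ?_, ?_⟩
      · rw [exists_gluingMat_smul_iff hL, smul_inv_smul, hwim]
        exact ⟨hwre, (le_sqrt_three_div_iff hy0.le).1 hy⟩
      · rw [← moeb_ofUHP, ← re_im_eq_ofUHP hwre, hwim]

lemma halfArc_subset : halfArc ⊆ {∞} ∪ verticalLine (1 / 2) := by
  rintro s (rfl | ⟨z, hz, rfl⟩)
  · exact Or.inl rfl
  · exact Or.inr ⟨z, hz.1, rfl⟩

lemma delta_eq (hp : p.Prime) (hp2 : p ≠ 2) (hL : 2 * L + 1 = (p : ℤ)) :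
    delta p = axisArc ∪ lowerArc p ∪ halfArc := by
  ext s
  rw [mem_delta_iff hp hp2 hL]
  constructor
  · rintro (rfl | rfl | ⟨z, hz | hz | hz, rfl⟩)
    · exact Or.inr (Or.inl rfl)
    · exact Or.inl (Or.inr (Or.inl rfl))
    · exact Or.inl (Or.inl (Or.inr ⟨z, hz, rfl⟩))
    · exact Or.inr (Or.inr ⟨z, hz, rfl⟩)
    · exact Or.inl (Or.inr (Or.inr ⟨z, hz, rfl⟩))
  · rintro (((((rfl | rfl) | ⟨z, hz, rfl⟩)) | rfl | ⟨z, hz, rfl⟩) | rfl | ⟨z, hz, rfl⟩)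
    · exact Or.inr (Or.inl rfl)
    · exact Or.inl rfl
    · exact Or.inr (Or.inr ⟨z, Or.inl hz, rfl⟩)
    · exact Or.inr (Or.inl rfl)
    · exact Or.inr (Or.inr ⟨z, Or.inr (Or.inr hz), rfl⟩)
    · exact Or.inl rfl
    · exact Or.inr (Or.inr ⟨z, Or.inr (Or.inl hz), rfl⟩)

lemma isArc_axisArc_union_halfArc :
    IsArc ((0 : ℂ) : OnePoint ℂ) (vertex 1) (axisArc ∪ halfArc) := by
  have h : IsSimpleCurve ((0 : ℂ) : OnePoint ℂ) (vertex 1) (axisArc ∪ halfArc) := by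
    refine isGeodesicArc_axisArc.isArc.union isGeodesicArc_halfArc.isArc.symm ?_
    rintro s hs (rfl | ⟨z, hz, rfl⟩)
    · exact Or.inl rfl
    · exfalso
      rcases hs with (h | h) | ⟨w, hw, h⟩
      · exact zero_ne_ofUHP z h.symm
      · exact ofUHP_ne_infty z h
      · rw [ofUHP_injective h] at hw
        have hw' : z.re = 0 := hw
        rw [hw'] at hz
        norm_num at hz
  refine h.isArc ?_
  rw [vertex_one]
  exact zero_ne_ofUHP _

lemma isSimpleCurve_delta (hp : p.Prime) (hp2 : p ≠ 2) (hL : 2 * L + 1 = (p : ℤ)) :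
    IsSimpleCurve (vertex L) (vertex 1) (delta p) := by
  have e : delta p = lowerArc p ∪ (axisArc ∪ halfArc) := by
    rw [delta_eq hp hp2 hL, union_comm axisArc, union_assoc]
  rw [e]
  refine (isGeodesicArc_lowerArc hL).isArc.symm.union isArc_axisArc_union_halfArc ?_
  rintro s (rfl | ⟨z, hz, rfl⟩) hs
  · exact Or.inl rfl
  right
  have hz' := (exists_gluingMat_smul_iff hL z).1 hz
  have hg : Equiv₀ p (ofUHP z) (ofUHP (gluingMat hL • z)) :=
    ⟨gluingMat hL, gluingMat_mem hL, moeb_ofUHP _ _⟩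
  rcases hs with ((h | h) | ⟨w, hw, h⟩) | h | ⟨w, hw, h⟩
  · exact absurd h.symm (zero_ne_ofUHP z)
  · exact absurd h (ofUHP_ne_infty z)
  · exfalso
    obtain rfl := ofUHP_injective h
    have hw' : w.re = 0 := hw
    have e := eq_of_equiv₀_of_lines hp hp2 (Or.inl hw') (Or.inr hz'.1) hg
    rw [← e, hw'] at hz'
    norm_num at hz'
  · exact absurd h (ofUHP_ne_infty z)
  -- A common point of the boundary arc and the half-line is fixed by `gluingMat` and equals `c_1`,
  -- so it is `c_L` as well: the end points of the curve coincide.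
  · obtain rfl := ofUHP_injective h
    have e := eq_of_equiv₀_of_lines hp hp2 (Or.inr hw.1) (Or.inr hz'.1) hg
    rw [← e] at hz'
    have h1 := eq_vertexOne hw.1 (le_antisymm hz'.2 hw.2)
    refine ⟨?_, by rw [h1, vertex_one]⟩
    rw [vertex_eq_moeb hL]
    congr 1
    rw [eq_inv_smul_iff, ← e, h1]

/-! ### The curve on the glued surface -/

lemma continuous_proj (p : ℕ) : Continuous (proj p) := continuous_quotient_mk'

lemma proj_eq_iff {z w : Xp p} : proj p z = proj p w ↔ Equiv₀ p z w :=
  ⟨fun h => Quotient.exact (s := gluing p) h, fun h => Quotient.sound (s := gluing p) h⟩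

lemma fixTilde_eq_glue_delta (hL : 2 * L + 1 = (p : ℤ)) : fixTilde p = glue p (delta p) := by
  apply Subset.antisymm
  · rintro _ ⟨z, hz, rfl⟩
    rcases mem_delta_or_sigma_mem_delta hL hz with h | h
    · exact ⟨z, h, rfl⟩
    · exact ⟨⟨sigma z, h.1.1⟩, h, proj_eq_iff.2 (mem_fixSet_iff.1 hz).2.symm⟩
  · rintro _ ⟨z, hz, rfl⟩
    exact ⟨z, delta_subset_fixSet p hz, rfl⟩

lemma exists_equiv₀_mem_iff (hp : p.Prime) (hp2 : p ≠ 2) (hL : 2 * L + 1 = (p : ℤ))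
    {K : Set Sphere} (hK : K ⊆ delta p) {z : Sphere} (hz : z ∈ delta p) :
    (∃ w ∈ K, Equiv₀ p w z) ↔
      z ∈ K ∨ z ∈ {z | z = vertex 1 ∧ vertex L ∈ K} ∨ z ∈ {z | z = vertex L ∧ vertex 1 ∈ K} := by
  constructor
  · rintro ⟨w, hw, h⟩
    rcases (equiv₀_iff_of_mem_delta hp hp2 hL (hK hw) hz).1 h with rfl | ⟨rfl, rfl⟩ | ⟨rfl, rfl⟩
    · exact Or.inl hw
    · exact Or.inr (Or.inl ⟨rfl, hw⟩)
    · exact Or.inr (Or.inr ⟨rfl, hw⟩)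
  · rintro (h | ⟨rfl, h⟩ | ⟨rfl, h⟩)
    · exact ⟨z, h, Equiv₀.refl p z⟩
    · exact ⟨_, h, equiv₀_vertex hL⟩
    · exact ⟨_, h, (equiv₀_vertex hL).symm⟩

/-- Any point equivalent to one of `K` is fixed modulo `Γ₀(p)`, hence lies in `delta` or in its
mirror image. In `delta` the saturation adds to `K` at most the other vertex, so altogether it is
`K'` and its reflection. -/
lemma isClosed_saturation (hp : p.Prime) (hp2 : p ≠ 2) (hL : 2 * L + 1 = (p : ℤ))
    {K : Set Sphere} (hK : K ⊆ delta p) (hKc : IsClosed K) (hv : vertex L ∈ delta p)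
    (hv' : vertex 1 ∈ delta p) :
    IsClosed {z : Xp p | ∃ w ∈ K, Equiv₀ p w z} := by
  set K' : Set Sphere := K ∪ ({z | z = vertex 1 ∧ vertex L ∈ K} ∪
    {z | z = vertex L ∧ vertex 1 ∈ K}) with hK'
  have hK'δ : K' ⊆ delta p := by
    rintro z (h | ⟨rfl, -⟩ | ⟨rfl, -⟩)
    · exact hK h
    · exact hv'
    · exact hv
  have hc : IsClosed K' := by
    refine hKc.union (IsClosed.union ?_ ?_)
    · exact ((finite_singleton (vertex 1)).subset fun z h => h.1).isClosed
    · exact ((finite_singleton (vertex L)).subset fun z h => h.1).isClosed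
  have e : {z : Xp p | ∃ w ∈ K, Equiv₀ p w z} =
      Subtype.val ⁻¹' (K' ∪ sigma ⁻¹' K') := by
    ext z
    constructor
    · rintro ⟨w, hw, h⟩
      have hfix := Equiv₀.fixed h.symm (mem_fixSet_iff.1 (hK hw)).2
      rcases mem_delta_or_sigma_mem_delta hL (mem_fixSet_iff.2 ⟨z.2, hfix⟩) with h' | h'
      · exact Or.inl ((exists_equiv₀_mem_iff hp hp2 hL hK h').1 ⟨w, hw, h⟩)
      · exact Or.inr ((exists_equiv₀_mem_iff hp hp2 hL hK h').1 ⟨w, hw, h.trans hfix⟩)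
    · rintro (h | h)
      · exact (exists_equiv₀_mem_iff hp hp2 hL hK (hK'δ h)).2 h
      · have hδ : sigma z ∈ delta p := hK'δ h
        obtain ⟨w, hw, hwz⟩ := (exists_equiv₀_mem_iff hp hp2 hL hK hδ).2 h
        have hfix := (mem_fixSet_iff.1 hδ).2
        rw [sigma_sigma] at hfix
        exact ⟨w, hw, hwz.trans hfix⟩
  rw [e]
  exact (hc.union (hc.preimage continuous_sigma)).preimage continuous_subtype_val

lemma isSimpleClosedCurve_fixTilde (hp : p.Prime) (hp2 : p ≠ 2) (hL : 2 * L + 1 = (p : ℤ)) :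
    IsSimpleClosedCurve (fixTilde p) := by
  obtain ⟨h, hr, hs⟩ := isSimpleCurve_delta hp hp2 hL
  have hmem : ∀ t, h t ∈ delta p := fun t => hr ▸ mem_range_self t
  have hv : vertex L ∈ delta p := h.source ▸ hmem 0
  have hv' : vertex 1 ∈ delta p := h.target ▸ hmem 1
  set k : unitInterval → Xp p := fun t => ⟨h t, (hmem t).1.1⟩ with hk
  have hkc : Continuous k := h.continuous.subtype_mk _
  have e : fixTilde p = range fun t => proj p (k t) := by
    rw [fixTilde_eq_glue_delta hL]
    ext x
    constructor
    · rintro ⟨z, hz, rfl⟩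
      rw [← hr] at hz
      obtain ⟨t, ht⟩ := hz
      exact ⟨t, congrArg _ (Subtype.ext ht)⟩
    · rintro ⟨t, rfl⟩
      exact ⟨k t, hmem t, rfl⟩
  -- The value `1` cannot be dropped here: for `p = 3` the two vertices are the same point.
  have h0 : ∀ s, h s = vertex L → s = 0 ∨ s = 1 := by
    intro s hsv
    rcases unitInterval.nonneg'.eq_or_lt with h' | h'
    · exact Or.inl h'.symm
    · exact Or.inr (hs 0 s h' (h.source.trans hsv.symm)).2
  have h1 : ∀ s, h s = vertex 1 → s = 0 ∨ s = 1 := by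
    intro s hsv
    rcases unitInterval.le_one'.eq_or_lt with h' | h'
    · exact Or.inr h'
    · exact Or.inl (hs s 1 h' (hsv.trans h.target.symm)).1
  rw [e]
  apply isSimpleClosedCurve_range
  · exact (continuous_proj p).comp hkc
  · apply proj_eq_iff.2
    change Equiv₀ p (h 0) (h 1)
    rw [h.source, h.target]
    exact equiv₀_vertex hL
  · intro s t hst hp'
    rcases (equiv₀_iff_of_mem_delta hp hp2 hL (hmem s) (hmem t)).1 (proj_eq_iff.1 hp') with
      h' | ⟨h', h''⟩ | ⟨h', h''⟩
    · exact hs s t hst h'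
    · rcases h0 s h' with rfl | rfl
      · rcases h1 t h'' with rfl | rfl
        · exact absurd hst (lt_irrefl _)
        · exact ⟨rfl, rfl⟩
      · exact absurd hst (not_lt.2 unitInterval.le_one')
    · rcases h1 s h' with rfl | rfl
      · rcases h0 t h'' with rfl | rfl
        · exact absurd hst (lt_irrefl _)
        · exact ⟨rfl, rfl⟩
      · exact absurd hst (not_lt.2 unitInterval.le_one')
  · intro C hC
    -- A set in the quotient is closed when its preimage is, and this preimage is the saturation of
    -- the compact set `h '' C`.
    have hq : IsClosed (proj p ⁻¹' ((fun t => proj p (k t)) '' C)) := by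
      have e' : proj p ⁻¹' ((fun t => proj p (k t)) '' C) =
          {z : Xp p | ∃ w ∈ h '' C, Equiv₀ p w z} := by
        ext z
        constructor
        · rintro ⟨t, ht, h'⟩
          exact ⟨h t, ⟨t, ht, rfl⟩, proj_eq_iff.1 h'⟩
        · rintro ⟨_, ⟨t, ht, rfl⟩, h'⟩
          exact ⟨t, ht, proj_eq_iff.2 h'⟩
      rw [e']
      apply isClosed_saturation hp hp2 hL _ _ hv hv'
      · rintro _ ⟨t, -, rfl⟩
        exact hmem t
      · exact (hC.isCompact.image h.continuous).isClosed
    exact isQuotientMap_quotient_mk'.isClosed_preimage.1 hq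

end

end GammaZeroFix
open GammaZeroFix in
theorem lemma6p1 (p : ℕ) (hp : p.Prime) (hp2 : p ≠ 2) (L : ℤ) (hL : 2 * L + 1 = (p : ℤ)) :
    -- (i)
    (IsSimpleCurve (vertex L) (vertex 1) (delta p) ∧
      (∃ A₁ A₂ A₃ : Set Sphere,
        IsGeodesicArc ((0 : ℂ) : OnePoint ℂ) ∞ A₁ ∧
        A₁ = {((0 : ℂ) : OnePoint ℂ), ∞} ∪ verticalLine 0 ∧
        IsGeodesicArc ((0 : ℂ) : OnePoint ℂ) (vertex L) A₂ ∧
        IsGeodesicArc (vertex 1) ∞ A₃ ∧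
        A₃ ⊆ {∞} ∪ verticalLine (1 / 2) ∧
        delta p = A₁ ∪ A₂ ∪ A₃) ∧
      fixSet (CongruenceSubgroup.Gamma0 p) (Xp p) = delta p ∪ sigma '' delta p) ∧
    -- (ii)
    (IsSimpleClosedCurve (fixTilde p) ∧
      (∃ x : Xp p, (x : Sphere) = ∞ ∧ proj p x ∈ fixTilde p) ∧
      Equiv₀ p (vertex L) (vertex 1) ∧
      fixTilde p = glue p (delta p) ∧
      (∀ z ∈ delta p, ∀ w ∈ delta p, Equiv₀ p z w ↔
        z = w ∨ (z = vertex L ∧ w = vertex 1) ∨ (z = vertex 1 ∧ w = vertex L))) ∧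
    -- (iii)
    (IsCompleteGeodesic ((0 : ℂ) : OnePoint ℂ) ∞ (verticalLine 0) ∧
      IsCompleteGeodesic ((1 / 2 : ℂ) : OnePoint ℂ) ∞ (verticalLine (1 / 2)) ∧
      orbitMap p '' fixSet (CongruenceSubgroup.Gamma0 p) (range ofUHP) =
        orbitMap p '' verticalLine 0 ∪ orbitMap p '' verticalLine (1 / 2) ∧
      (∀ γ ∈ CongruenceSubgroup.Gamma0 p,
        moeb γ '' verticalLine 0 ≠ verticalLine (1 / 2)) ∧
      InjOn (orbitMap p) (verticalLine 0 ∪ verticalLine (1 / 2)) ∧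
      Equiv₀ p ((0 : ℂ) : OnePoint ℂ) ((1 / 2 : ℂ) : OnePoint ℂ)) := by
  refine ⟨⟨isSimpleCurve_delta hp hp2 hL, ⟨axisArc, lowerArc p, halfArc, isGeodesicArc_axisArc,
    rfl, isGeodesicArc_lowerArc hL, isGeodesicArc_halfArc, halfArc_subset,
    delta_eq hp hp2 hL⟩, fixSet_eq hL⟩, ⟨isSimpleClosedCurve_fixTilde hp hp2 hL,
    ⟨⟨∞, infty_mem_Xp p⟩, rfl, ⟨_, delta_subset_fixSet p (infty_mem_delta p), rfl⟩⟩,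
    equiv₀_vertex hL, fixTilde_eq_glue_delta hL,
    fun z hz w hw => equiv₀_iff_of_mem_delta hp hp2 hL hz hw⟩,
    by simpa using isCompleteGeodesic_verticalLine 0,
    by simpa using isCompleteGeodesic_verticalLine (1 / 2), image_orbitMap_fixSet hp hp2,
    fun γ hγ => image_verticalLine_ne hp hp2 hγ, injOn_orbitMap hp hp2, equiv₀_zero_half hL⟩
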